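/- Functions on $(0,1)$ are Lebesgue measurable and real-valued; $f^*$ is the nonincreasing rearrangement of $f$ and $f^{**}(t)=\frac1t\int_0^t f^*$. Let $0<\alpha<1$, $\beta>0$, $\alpha+1/\beta\ge 1$ and $$(H_\alpha^\beta f)(t)=\int_{t^\beta}^1 f(s)\,s^{\alpha-1}\,ds,\quad t\in(0,1).$$ We write $H_\alpha^\beta\colon X\to Y$ if there is a constant $C$ with $\|H_\alpha^\beta f\|_Y\le C\|f\|_X$ for all $f\in X$. A Young function is a function $A(t)=\int_0^t a(s)\,ds$, $t\ge0$, where $a\colon[0,\infty)\to[0,\infty)$ is nondecreasing and right-continuous with $a(0)=0$, $a(s)>0$ for $s>0$ and $a(s)\to\infty$ as $s\to\infty$; $\widetilde A(t)=\sup_{s>0}(st-A(s))$ is its complementary function, and $L^A(0,1)$ is the Orlicz space of $A$ with the Luxemburg norm. Let $L^A(0,1)$ be the Orlicz space of a Young function $A$ and let $M(0,1)$ be the Marcinkiewicz endpoint space with norm $\|f\|_M=\sup_{0<t<1}f^{**}(t)\,\varphi(t)$, where $\varphi$ is quasiconcave on $[0,1)$ (that is, $\varphi(0)=0$, $\varphi>0$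 and $\varphi$ is nondecreasing on $(0,1)$, and $\varphi(t)/t$ is nonincreasing on $(0,1)$) and $$\sup_{0<t<1}\varphi(t^{1/\beta})\,t^{\alpha-1}=\infty.$$ Then among the rearrangement-invariant Banach function spaces $X$ over $(0,1)$ with $H_\alpha^\beta\colon X\to M(0,1)$ there is a largest one with respect to inclusion, $X(0,1)$, and there is a Young function $B$ such that the Orlicz space $L^B(0,1)$ has the same fundamental function as $X(0,1)$ up to equivalence, i.e. $\|\chi_{(0,t)}\|_{L^B}\simeq\|\chi_{(0,t)}\|_{X}$ for $t\in(0,1)$. For every such $B$, $$H_\alpha^\beta\colon L^A(0,1)\to M(0,1)$$ holds if and only if there exist constants $C>0$ and $K>0$ such that $$\int_1^t\frac{\widetilde A(s)}{s^{1/(1-\alpha)+1}}\,ds\le K\,\frac{\widetilde B(Ct)}{t^{1/(1-\alpha)}}\quad\text{for all }t\in(2,\infty).$$ -/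

import Mathlib

open MeasureTheory Set Filter Topology
open scoped ENNReal NNReal

noncomputable section

namespace OrliczMarcinkiewicz

/-- Lebesgue measure on the interval `(0,1)`. Functions on `(0,1)` are represented by functions
`ℝ → ℝ`, of which only the restriction to `(0,1)` matters. -/
def muI : Measure ℝ := volume.restrict (Ioo 0 1)

/-- `f` is a (Lebesgue) measurable function on `(0,1)`. -/
def MemM (f : ℝ → ℝ) : Prop := AEMeasurable f muI

/-- `f` is a nonnegative (Lebesgue) measurable function on `(0,1)`. -/
def MemMPlus (f : ℝ → ℝ) : Prop := AEMeasurable f muI ∧ ∀ᵐ x ∂muI, 0 ≤ f x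

/-- The distribution function `lam ↦ |{x ∈ (0,1) : |f x| > lam}|`. -/
def distribution (f : ℝ → ℝ) (lam : ℝ) : ℝ≥0∞ := muI {x | lam < |f x|}

/-- The nonincreasing rearrangement `f^*(t)`, for `0 < t < 1`. -/
def rearrangement (f : ℝ → ℝ) (t : ℝ) : ℝ :=
  sInf {lam : ℝ | 0 < lam ∧ distribution f lam ≤ ENNReal.ofReal t}

/-- The Hardy average `f^{**}(t) = (1/t) ∫_0^t f^*(s) ds`, for `0 < t < 1`, valued in `[0,∞]`. -/
def hardyAverage (f : ℝ → ℝ) (t : ℝ) : ℝ≥0∞ :=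
  (∫⁻ s in Ioo 0 t, ENNReal.ofReal (rearrangement f s)) / ENNReal.ofReal t

/-- The characteristic function of `(0,t)`. -/
def chi (t : ℝ) : ℝ → ℝ := (Ioo (0 : ℝ) t).indicator (fun _ => 1)

/-- `ρ` is a rearrangement-invariant Banach function norm on the nonnegative measurable functions
on `(0,1)`. The values of `ρ` at other functions are irrelevant. -/
structure IsRINorm (ρ : (ℝ → ℝ) → ℝ≥0∞) : Prop where
  eq_zero_iff : ∀ f, MemMPlus f → (ρ f = 0 ↔ f =ᵐ[muI] 0)
  smul : ∀ f, MemMPlus f → ∀ a : ℝ, 0 ≤ a → ρ (fun x => a * f x) = ENNReal.ofReal a * ρ f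
  add_le : ∀ f g, MemMPlus f → MemMPlus g → ρ (fun x => f x + g x) ≤ ρ f + ρ g
  mono : ∀ f g, MemMPlus f → MemMPlus g → (∀ᵐ x ∂muI, f x ≤ g x) → ρ f ≤ ρ g
  fatou : ∀ (f : ℕ → ℝ → ℝ) (g : ℝ → ℝ), (∀ n, MemMPlus (f n)) → MemMPlus g →
    (∀ᵐ x ∂muI, Monotone (fun n => f n x) ∧ Tendsto (fun n => f n x) atTop (𝓝 (g x))) →
    Tendsto (fun n => ρ (f n)) atTop (𝓝 (ρ g))
  one_lt_top : ρ (fun _ => 1) < ∞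
  lintegral_le : ∃ C : ℝ≥0, ∀ f, MemMPlus f → ∫⁻ x, ENNReal.ofReal (f x) ∂muI ≤ C * ρ f
  rearrangement_eq : ∀ f, MemMPlus f → ρ f = ρ (rearrangement f)

/-- The norm `‖f‖ = ρ(|f|)` of the r.i. space of a function norm `ρ`; `f` belongs to the space iff
`f` is measurable and this is finite. -/
def riNorm (ρ : (ℝ → ℝ) → ℝ≥0∞) (f : ℝ → ℝ) : ℝ≥0∞ := ρ (fun x => |f x|)

/-- `φ` is quasiconcave on `[0,1)`. -/
structure IsQuasiconcave (φ : ℝ → ℝ) : Prop where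
  zero : φ 0 = 0
  pos : ∀ t ∈ Ioo (0 : ℝ) 1, 0 < φ t
  mono : MonotoneOn φ (Ioo 0 1)
  anti : AntitoneOn (fun t => φ t / t) (Ioo 0 1)

/-- The norm `sup_{0<t<1} f^{**}(t) φ(t)` of the Marcinkiewicz endpoint space `M_φ(0,1)`. -/
def marcinkiewiczNorm (φ : ℝ → ℝ) (f : ℝ → ℝ) : ℝ≥0∞ :=
  ⨆ t ∈ Ioo (0 : ℝ) 1, hardyAverage f t * ENNReal.ofReal (φ t)

/-- `A` is (on `[0,∞)`) a Young function. -/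
def IsYoung (A : ℝ → ℝ) : Prop :=
  ∃ a : ℝ → ℝ, a 0 = 0 ∧ (∀ s, 0 < s → 0 < a s) ∧
    (∀ s, 0 ≤ s → ContinuousWithinAt a (Ici s) s) ∧
    MonotoneOn a (Ici 0) ∧ Tendsto a atTop atTop ∧
    ∀ t, 0 ≤ t → A t = ∫ s in (0 : ℝ)..t, a s

/-- The complementary function `t ↦ sup_{s>0} (s t - A s)`. The supremum is finite whenever `A` is
a Young function and `t ≥ 0`. -/
def complementary (A : ℝ → ℝ) (t : ℝ) : ℝ := sSup ((fun s => s * t - A s) '' Ioi 0)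

/-- The Luxemburg norm on the Orlicz space `L^A(0,1)`; `f` belongs to the space iff `f` is
measurable and this is finite. -/
def luxemburgNorm (A : ℝ → ℝ) (f : ℝ → ℝ) : ℝ≥0∞ :=
  ⨅ (lam : ℝ) (_ : 0 < lam ∧ ∫⁻ x, ENNReal.ofReal (A (|f x| / lam)) ∂muI ≤ 1),
    ENNReal.ofReal lam

/-- The operator `(H_α^β f)(t) = ∫_{t^β}^1 f(s) s^{α-1} ds`, for `0 < t < 1`. -/
def hardyOp (α β : ℝ) (f : ℝ → ℝ) (t : ℝ) : ℝ := ∫ s in Ioo (t ^ β) 1, f s * s ^ (α - 1)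

/-- `H_α^β : X → Y` boundedly, where `X`, `Y` are the spaces of measurable functions with finite
norm `NX`, `NY`: on `X` the defining integral converges, and `‖H f‖_Y ≤ C ‖f‖_X`. -/
def HardyBounded (α β : ℝ) (NX NY : (ℝ → ℝ) → ℝ≥0∞) : Prop :=
  ∃ C : ℝ≥0, ∀ f, MemM f → NX f < ∞ →
    (∀ t ∈ Ioo (0 : ℝ) 1, IntegrableOn (fun s => f s * s ^ (α - 1)) (Ioo (t ^ β) 1)) ∧
    NY (hardyOp α β f) ≤ C * NX f

/-- The r.i. space of `ρ` is the largest (with respect to inclusion) r.i. space `X` over `(0,1)`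
such that `H_α^β : X → M_φ`. -/
structure IsLargestRI (α β : ℝ) (φ : ℝ → ℝ) (ρ : (ℝ → ℝ) → ℝ≥0∞) : Prop where
  isRINorm : IsRINorm ρ
  bounded : HardyBounded α β (riNorm ρ) (marcinkiewiczNorm φ)
  largest : ∀ σ, IsRINorm σ → HardyBounded α β (riNorm σ) (marcinkiewiczNorm φ) →
    ∀ f, MemM f → riNorm σ f < ∞ → riNorm ρ f < ∞

/-- Two norms have the same fundamental function `t ↦ ‖χ_(0,t)‖` on `(0,1)`, up to equivalence. -/
def FundamentalEquiv (N₁ N₂ : (ℝ → ℝ) → ℝ≥0∞) : Prop :=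
  ∃ C : ℝ≥0, ∀ t ∈ Ioo (0 : ℝ) 1, N₁ (chi t) ≤ C * N₂ (chi t) ∧ N₂ (chi t) ≤ C * N₁ (chi t)

end OrliczMarcinkiewicz

end

open OrliczMarcinkiewicz

namespace OrliczMarcinkiewicz

/-! ### The nonincreasing rearrangement -/

/-! Put `ψ τ = φ (τ ^ (1 / β))` and let `k_τ s = min (τ ^ (α - 1)) (s ^ (α - 1))` be the kernel
`kern`.

The optimal space. By Tonelli, `∫_0^t H|f|` is the integral of `|f s| s ^ (α - 1) min t (s ^ (1 /
β))`. Because `α - 1 + 1 / β ≥ 0`, the factor next to `|f s|` is at most `t k_τ(s)` with `τ = t ^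
β`. Hence the Marcinkiewicz norm of `H f` is at most `sup_τ ψ(τ) ∫ f^* k_τ`, which is `optimalNorm`.
It is a rearrangement-invariant norm since `k_τ` is nonincreasing (Hardy's lemma). It is optimal:
for `τ ≤ 1/2`, test any admissible space on `f^*` translated to `(τ,1)`. The translate is no larger
than `f` in rearrangement, and `H` of it at `τ ^ (1 / β)` is at least a quarter of `∫ f^* k_τ`
(`IsRINorm.pairing_le`). Inclusions of r.i. spaces are continuous, so any other largest space has an
equivalent norm and only `optimalNorm` has to be studied.

The function `B`. The fundamental function of the optimal space is comparable to `t * tail α ψ t`,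
where `tail` is the supremum of `ψ(τ) τ ^ (α - 1)` over `τ ≥ t`. For a Young function `B` with this
fundamental function, the complementary function takes values comparable to `1/t` at constant
multiples of `tail α ψ t`. Such a `B` exists because this fundamental function is quasiconcave and
tends to `0` at `0`, and because `tail` is unbounded.

The criterion. Young's inequality and its equality case turn boundedness on `L^A` into a uniform
bound, for some `c > 0`, of the integrals over `(τ,1)` of the complementary function of `A` at `c
ψ(τ) s ^ (α - 1)`. With `p = 1 / (1 - α)`, `c' = c ψ(τ)` and `w = c' τ ^ (α - 1)`, the substitution
`y = c' s ^ (α - 1)` gives `p c' ^ p` times the integral of the complementary function over `y ^ (p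
+ 1)` from `c'` to `w`. Since `c' ^ p = w ^ p τ`, the bound compares that integral with `1 / (τ w ^
p)`, and `1/τ` is then exchanged for the complementary function of `B` at a multiple of `w`. For
necessity, a given `t` is matched with a nearly largest `τ` satisfying `w ≥ t`. -/

instance : IsProbabilityMeasure muI := ⟨by simp [muI]⟩

theorem muI_Ioo {d : ℝ} (h1 : d ≤ 1) : muI (Ioo 0 d) = ENNReal.ofReal d := by
  rw [muI, Measure.restrict_apply measurableSet_Ioo, Ioo_inter_Ioo]
  simp [h1]

theorem setLIntegral_muI (u : ℝ → ℝ≥0∞) {t : ℝ} (ht : t ≤ 1) :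
    ∫⁻ s in Ioo 0 t, u s ∂muI = ∫⁻ s in Ioo 0 t, u s := by
  rw [muI, Measure.restrict_restrict measurableSet_Ioo, inter_eq_left.2 (Ioo_subset_Ioo_right ht)]

theorem ae_muI_of_forall {p : ℝ → Prop} (h : ∀ x ∈ Ioo (0 : ℝ) 1, p x) : ∀ᵐ x ∂muI, p x :=
  (ae_restrict_iff' measurableSet_Ioo).2 (ae_of_all _ h)

theorem ae_mem_Ioo : ∀ᵐ x ∂muI, x ∈ Ioo (0 : ℝ) 1 := ae_muI_of_forall fun _ h => h

theorem distribution_anti (f : ℝ → ℝ) : Antitone (distribution f) := fun _ _ h =>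
  measure_mono fun _ hx => lt_of_le_of_lt h hx

theorem distribution_le_one (f : ℝ → ℝ) (l : ℝ) : distribution f l ≤ 1 := prob_le_one

theorem distribution_mono {f g : ℝ → ℝ} (h : ∀ᵐ x ∂muI, |f x| ≤ |g x|) (l : ℝ) :
    distribution f l ≤ distribution g l := by
  refine measure_mono_ae ?_
  filter_upwards [h] with x hx hl using lt_of_lt_of_le hl hx

/-- Right continuity of the distribution function, from continuity of the measure along increasing
unions. -/
theorem distribution_le_of_forall_gt {f : ℝ → ℝ} {l : ℝ} {c : ℝ≥0∞}
    (h : ∀ l', l < l' → distribution f l' ≤ c) : distribution f l ≤ c := by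
  have hU : {x | l < |f x|} = ⋃ n : ℕ, {x | l + 1 / ((n : ℝ) + 1) < |f x|} := by
    ext x
    simp only [mem_ofPred_eq, mem_iUnion]
    constructor
    · intro hx
      obtain ⟨n, hn⟩ := exists_nat_one_div_lt (sub_pos.2 hx)
      exact ⟨n, by linarith⟩
    · rintro ⟨n, hn⟩
      have : (0 : ℝ) < 1 / ((n : ℝ) + 1) := by positivity
      linarith
  have hmono : Monotone fun n : ℕ => {x | l + 1 / ((n : ℝ) + 1) < |f x|} := by
    intro m n hmn x hx
    have : 1 / ((n : ℝ) + 1) ≤ 1 / ((m : ℝ) + 1) := by gcongr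
    simp only [mem_ofPred_eq] at hx ⊢
    linarith
  rw [distribution, hU, hmono.measure_iUnion]
  refine iSup_le fun n => h _ ?_
  have : (0 : ℝ) < 1 / ((n : ℝ) + 1) := by positivity
  linarith

/-- Real values and finite measure force the distribution function to `0`. Thus the infimum defining
`rearrangement` is over a nonempty set and is never the default value of `sInf`. -/
theorem exists_distribution_le {f : ℝ → ℝ} (hf : MemM f) {t : ℝ} (ht : 0 < t) :
    ∃ l, 0 < l ∧ distribution f l ≤ ENNReal.ofReal t := by
  have hanti : Antitone fun n : ℕ => {x | (n : ℝ) < |f x|} := by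
    intro m n hmn x hx
    have hx : (n : ℝ) < |f x| := hx
    exact lt_of_le_of_lt (Nat.cast_le.2 hmn) hx
  have h0 := tendsto_measure_iInter_atTop (μ := muI)
    (s := fun n : ℕ => {x | (n : ℝ) < |f x|})
    (fun n => nullMeasurableSet_lt aemeasurable_const hf.abs) hanti
    ⟨0, measure_ne_top _ _⟩
  have hE : (⋂ n : ℕ, {x | (n : ℝ) < |f x|}) = ∅ := by
    ext x
    simp only [mem_iInter, mem_ofPred_eq, mem_empty_iff_false, iff_false, not_forall, not_lt]
    exact exists_nat_ge _
  rw [hE, measure_empty] at h0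
  have h1 := (h0.eventually (gt_mem_nhds (ENNReal.ofReal_pos.2 ht))).and (eventually_gt_atTop 0)
  obtain ⟨n, hn, hn0⟩ := h1.exists
  exact ⟨n, by exact_mod_cast hn0, hn.le⟩

theorem rearrangement_nonneg (f : ℝ → ℝ) (t : ℝ) : 0 ≤ rearrangement f t :=
  Real.sInf_nonneg fun _ hl => hl.1.le

theorem rearrangement_le_of_pos {f : ℝ → ℝ} {t l : ℝ} (hl : 0 < l)
    (h : distribution f l ≤ ENNReal.ofReal t) : rearrangement f t ≤ l :=
  csInf_le ⟨0, fun _ hl => hl.1.le⟩ ⟨hl, h⟩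

theorem rearrangement_le {f : ℝ → ℝ} {t l : ℝ} (hl : 0 ≤ l)
    (h : distribution f l ≤ ENNReal.ofReal t) : rearrangement f t ≤ l :=
  le_of_forall_gt_imp_ge_of_dense fun _ hl' =>
    rearrangement_le_of_pos (hl.trans_lt hl') ((distribution_anti f hl'.le).trans h)

/-- The rearrangement is the generalized inverse of the distribution function; right continuity of
the latter makes the infimum attained when it is positive, and also covers `l = 0`. -/
theorem rearrangement_le_iff {f : ℝ → ℝ} (hf : MemM f) {t l : ℝ} (ht : 0 < t) (hl : 0 ≤ l) :
    rearrangement f t ≤ l ↔ distribution f l ≤ ENNReal.ofReal t := by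
  refine ⟨fun h => distribution_le_of_forall_gt fun l' hl' => ?_, rearrangement_le hl⟩
  obtain ⟨m, hm, hml⟩ := exists_lt_of_csInf_lt (exists_distribution_le hf ht) (h.trans_lt hl')
  exact (distribution_anti f hml.le).trans hm.2

theorem lt_rearrangement_iff {f : ℝ → ℝ} (hf : MemM f) {t l : ℝ} (ht : 0 < t) (hl : 0 ≤ l) :
    l < rearrangement f t ↔ ENNReal.ofReal t < distribution f l := by
  rw [← not_le, rearrangement_le_iff hf ht hl, not_le]

theorem rearrangement_antitoneOn {f : ℝ → ℝ} (hf : MemM f) :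
    AntitoneOn (rearrangement f) (Ioi 0) := fun _ hs _ _ hst =>
  rearrangement_le (rearrangement_nonneg _ _)
    (((rearrangement_le_iff hf hs (rearrangement_nonneg _ _)).1 le_rfl).trans
      (ENNReal.ofReal_le_ofReal hst))

theorem memM_rearrangement {f : ℝ → ℝ} (hf : MemM f) : MemM (rearrangement f) :=
  aemeasurable_restrict_of_antitoneOn measurableSet_Ioo
    ((rearrangement_antitoneOn hf).mono fun _ h => h.1)

theorem memMPlus_rearrangement {f : ℝ → ℝ} (hf : MemM f) : MemMPlus (rearrangement f) :=
  ⟨memM_rearrangement hf, ae_of_all _ (rearrangement_nonneg f)⟩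

theorem rearrangement_mono {f g : ℝ → ℝ} (hg : MemM g)
    (h : ∀ l, 0 ≤ l → distribution f l ≤ distribution g l) {t : ℝ} (ht : 0 < t) :
    rearrangement f t ≤ rearrangement g t :=
  rearrangement_le (rearrangement_nonneg _ _)
    ((h _ (rearrangement_nonneg _ _)).trans
      ((rearrangement_le_iff hg ht (rearrangement_nonneg _ _)).1 le_rfl))

theorem distribution_rearrangement {f : ℝ → ℝ} (hf : MemM f) {l : ℝ} (hl : 0 ≤ l) :
    distribution (rearrangement f) l = distribution f l := by
  have hd : distribution f l ≠ ∞ := ne_top_of_le_ne_top ENNReal.one_ne_top (distribution_le_one f l)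
  have h1 : (distribution f l).toReal ≤ 1 := by
    simpa using ENNReal.toReal_mono ENNReal.one_ne_top (distribution_le_one f l)
  rw [← ENNReal.ofReal_toReal hd, ← muI_Ioo h1, distribution]
  refine measure_congr ?_
  filter_upwards [ae_mem_Ioo] with s hs
  refine propext ?_
  change l < |rearrangement f s| ↔ s ∈ Ioo 0 _
  rw [abs_of_nonneg (rearrangement_nonneg _ _), lt_rearrangement_iff hf hs.1 hl,
    ENNReal.ofReal_lt_iff_lt_toReal hs.1.le hd]
  simp [hs.1]

theorem rearrangement_congr {f g : ℝ → ℝ} (h : ∀ l, 0 ≤ l → distribution f l = distribution g l)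
    (t : ℝ) : rearrangement f t = rearrangement g t := by
  unfold rearrangement
  congr 1
  ext l
  exact and_congr_right fun hl => by rw [h l hl.le]

theorem rearrangement_rearrangement {f : ℝ → ℝ} (hf : MemM f) (t : ℝ) :
    rearrangement (rearrangement f) t = rearrangement f t :=
  rearrangement_congr (fun _ hl => distribution_rearrangement hf hl) t

theorem rearrangement_abs (f : ℝ → ℝ) (t : ℝ) :
    rearrangement (fun x => |f x|) t = rearrangement f t :=
  rearrangement_congr (fun _ _ => by simp [distribution]) t

/-- The excess of `f` over a level depends only on the distribution function. -/
theorem lintegral_excess {f : ℝ → ℝ} (hf : MemM f) (l : ℝ) :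
    ∫⁻ x, ENNReal.ofReal (|f x| - l) ∂muI = ∫⁻ r in Ioi 0, distribution f (r + l) := by
  have h0 : ∀ x, ENNReal.ofReal (|f x| - l) = ENNReal.ofReal (max (|f x| - l) 0) := by
    intro x; simp [ENNReal.ofReal, Real.toNNReal]
  simp_rw [h0]
  rw [lintegral_eq_lintegral_meas_lt muI (f := fun x => max (|f x| - l) 0)
    (ae_of_all _ fun x => le_max_right _ _)
    ((hf.abs.sub_const l).max aemeasurable_const)]
  refine setLIntegral_congr_fun measurableSet_Ioi fun r hr => ?_
  have hr : 0 < r := hr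
  simp only [distribution]
  congr 1
  ext x
  simp only [lt_max_iff, mem_ofPred_eq]
  constructor
  · rintro (h | h) <;> linarith
  · intro h; left; linarith

theorem lintegral_excess_rearrangement {f : ℝ → ℝ} (hf : MemM f) {l : ℝ} (hl : 0 ≤ l) :
    ∫⁻ x, ENNReal.ofReal (rearrangement f x - l) ∂muI
      = ∫⁻ x, ENNReal.ofReal (|f x| - l) ∂muI := by
  rw [lintegral_excess hf l]
  have := lintegral_excess (memM_rearrangement hf) l
  simp_rw [abs_of_nonneg (rearrangement_nonneg f _)] at this
  rw [this]
  refine setLIntegral_congr_fun measurableSet_Ioi fun r hr => ?_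
  have hr : 0 < r := hr
  exact distribution_rearrangement hf (by linarith)

theorem lintegral_rearrangement {f : ℝ → ℝ} (hf : MemM f) :
    ∫⁻ x, ENNReal.ofReal (rearrangement f x) ∂muI = ∫⁻ x, ENNReal.ofReal |f x| ∂muI := by
  simpa using lintegral_excess_rearrangement hf le_rfl

/-! ### Integrals of rearrangements over initial intervals, and Hardy's lemma -/

theorem setLIntegral_le_excess (u : ℝ → ℝ) {t : ℝ} (ht0 : 0 ≤ t) (ht : t ≤ 1) (l : ℝ) :
    ∫⁻ s in Ioo 0 t, ENNReal.ofReal (u s) ∂muI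
      ≤ ENNReal.ofReal (t * l) + ∫⁻ x, ENNReal.ofReal (u x - l) ∂muI := by
  calc ∫⁻ s in Ioo 0 t, ENNReal.ofReal (u s) ∂muI
      ≤ ∫⁻ s in Ioo 0 t, (ENNReal.ofReal l + ENNReal.ofReal (u s - l)) ∂muI := by
        refine lintegral_mono fun s => ?_
        rw [← sub_add_cancel (u s) l, add_comm]
        simpa using ENNReal.ofReal_add_le (p := l) (q := u s - l)
    _ = ENNReal.ofReal (t * l) + ∫⁻ s in Ioo 0 t, ENNReal.ofReal (u s - l) ∂muI := by
        rw [lintegral_add_left measurable_const, setLIntegral_const, muI_Ioo ht,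
          ENNReal.ofReal_mul ht0, mul_comm]
    _ ≤ _ := by gcongr; exact Measure.restrict_le_self

theorem setLIntegral_rearrangement_le {f : ℝ → ℝ} (hf : MemM f) {t : ℝ} (ht0 : 0 ≤ t) (ht : t ≤ 1)
    {l : ℝ} (hl : 0 ≤ l) :
    ∫⁻ s in Ioo 0 t, ENNReal.ofReal (rearrangement f s) ∂muI
      ≤ ENNReal.ofReal (t * l) + ∫⁻ x, ENNReal.ofReal (|f x| - l) ∂muI := by
  rw [← lintegral_excess_rearrangement hf hl]
  exact setLIntegral_le_excess _ ht0 ht l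

/-- The level `l = f^*(t)` attains the minimum over `l ≥ 0` of `t l + ∫ (|f| - l)_+`, since `f^* ≥
l` before `t` and `f^* ≤ l` after it. This variational formula replaces any choice of sets of
measure `t`. -/
theorem setLIntegral_rearrangement_eq {f : ℝ → ℝ} (hf : MemM f) {t : ℝ} (ht0 : 0 < t)
    (ht : t ≤ 1) :
    ∫⁻ s in Ioo 0 t, ENNReal.ofReal (rearrangement f s) ∂muI
      = ENNReal.ofReal (t * rearrangement f t)
        + ∫⁻ x, ENNReal.ofReal (|f x| - rearrangement f t) ∂muI := by
  refine le_antisymm (setLIntegral_rearrangement_le hf ht0.le ht (rearrangement_nonneg _ _)) ?_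
  set l := rearrangement f t
  have hl : 0 ≤ l := rearrangement_nonneg _ _
  rw [← lintegral_excess_rearrangement hf hl]
  calc ENNReal.ofReal (t * l) + ∫⁻ x, ENNReal.ofReal (rearrangement f x - l) ∂muI
      = (∫⁻ s in Ioo 0 t, ENNReal.ofReal l ∂muI)
          + ∫⁻ s in Ioo 0 t, ENNReal.ofReal (rearrangement f s - l) ∂muI := by
        rw [setLIntegral_const, muI_Ioo ht, ENNReal.ofReal_mul ht0.le, mul_comm]
        congr 1
        rw [← lintegral_indicator measurableSet_Ioo]
        refine lintegral_congr_ae ?_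
        filter_upwards [ae_mem_Ioo] with s hs
        by_cases h : s < t
        · rw [indicator_of_mem (show s ∈ Ioo 0 t from ⟨hs.1, h⟩)]
        · rw [indicator_of_notMem (fun h' => h h'.2), ENNReal.ofReal_eq_zero]
          exact sub_nonpos.2 (rearrangement_antitoneOn hf ht0 hs.1 (not_lt.1 h))
    _ = ∫⁻ s in Ioo 0 t, (ENNReal.ofReal l + ENNReal.ofReal (rearrangement f s - l)) ∂muI := by
        rw [lintegral_add_left measurable_const]
    _ ≤ _ := by
        refine setLIntegral_mono_ae' measurableSet_Ioo (ae_of_all _ fun s hs => ?_)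
        rw [← ENNReal.ofReal_add hl (sub_nonneg.2
          (rearrangement_antitoneOn hf hs.1 ht0 hs.2.le)), add_sub_cancel]

theorem setLIntegral_abs_le_rearrangement {f : ℝ → ℝ} (hf : MemM f) {t : ℝ} (ht0 : 0 < t)
    (ht : t ≤ 1) :
    ∫⁻ s in Ioo 0 t, ENNReal.ofReal |f s| ∂muI
      ≤ ∫⁻ s in Ioo 0 t, ENNReal.ofReal (rearrangement f s) ∂muI := by
  rw [setLIntegral_rearrangement_eq hf ht0 ht]
  exact setLIntegral_le_excess _ ht0.le ht _

/-- Test the variational formula for `f + g` at the sum of the two optimal levels; excesses over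
levels are subadditive. -/
theorem setLIntegral_rearrangement_add_le {f g : ℝ → ℝ} (hf : MemM f) (hg : MemM g) {t : ℝ}
    (ht0 : 0 < t) (ht : t ≤ 1) :
    ∫⁻ s in Ioo 0 t, ENNReal.ofReal (rearrangement (fun x => f x + g x) s) ∂muI
      ≤ ∫⁻ s in Ioo 0 t, (ENNReal.ofReal (rearrangement f s)
        + ENNReal.ofReal (rearrangement g s)) ∂muI := by
  have hfr := memM_rearrangement hf
  rw [lintegral_add_left' hfr.ennreal_ofReal.restrict, setLIntegral_rearrangement_eq hf ht0 ht,
    setLIntegral_rearrangement_eq hg ht0 ht]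
  set l := rearrangement f t
  set m := rearrangement g t
  have hl : 0 ≤ l := rearrangement_nonneg _ _
  have hm : 0 ≤ m := rearrangement_nonneg _ _
  refine (setLIntegral_rearrangement_le (hf.add hg) ht0.le ht (add_nonneg hl hm)).trans ?_
  have h1 : ENNReal.ofReal (t * (l + m)) = ENNReal.ofReal (t * l) + ENNReal.ofReal (t * m) := by
    rw [mul_add, ENNReal.ofReal_add] <;> positivity
  have h2 : ∫⁻ x, ENNReal.ofReal (|f x + g x| - (l + m)) ∂muI
      ≤ ∫⁻ x, ENNReal.ofReal (|f x| - l) ∂muI + ∫⁻ x, ENNReal.ofReal (|g x| - m) ∂muI := by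
    rw [← lintegral_add_left' (hf.abs.sub_const l).ennreal_ofReal]
    refine lintegral_mono fun x => ?_
    refine le_trans (ENNReal.ofReal_le_ofReal ?_) ENNReal.ofReal_add_le
    linarith [abs_add_le (f x) (g x)]
  rw [h1, add_add_add_comm]
  gcongr
  exact h2

/-- Hardy's lemma. -/
theorem lintegral_mul_antitone_le {u v : ℝ → ℝ≥0∞} (hu : AEMeasurable u muI)
    (hv : AEMeasurable v muI) {k : ℝ → ℝ} (hk0 : ∀ s ∈ Ioo (0 : ℝ) 1, 0 ≤ k s)
    (hk : AntitoneOn k (Ioo 0 1))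
    (h : ∀ t, 0 < t → t ≤ 1 → ∫⁻ s in Ioo 0 t, u s ∂muI ≤ ∫⁻ s in Ioo 0 t, v s ∂muI) :
    ∫⁻ s, u s * ENNReal.ofReal (k s) ∂muI ≤ ∫⁻ s, v s * ENNReal.ofReal (k s) ∂muI := by
  have hkm : AEMeasurable k muI := aemeasurable_restrict_of_antitoneOn measurableSet_Ioo hk
  -- Layer cake for `k` with respect to the measure of density `w`; it remains to compare the two
  -- measures on superlevel sets of `k`.
  have key : ∀ w : ℝ → ℝ≥0∞, AEMeasurable w muI →
      ∫⁻ s, w s * ENNReal.ofReal (k s) ∂muI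
        = ∫⁻ r in Ioi 0, (muI.withDensity w) {s | r < k s} := by
    intro w hw
    have hac := withDensity_absolutelyContinuous muI w
    rw [← lintegral_eq_lintegral_meas_lt (muI.withDensity w)
      (hac.ae_le (ae_muI_of_forall hk0)) (hkm.mono_ac hac),
      lintegral_withDensity_eq_lintegral_mul₀ hw hkm.ennreal_ofReal]
    rfl
  rw [key u hu, key v hv]
  refine lintegral_mono fun r => ?_
  set E := {s | r < k s} ∩ Ioo (0 : ℝ) 1
  -- As `k` is nonincreasing, its superlevel sets are initial intervals up to one endpoint.
  have hE : {s | r < k s} =ᵐ[muI] Ioo 0 (sSup E) := by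
    have h1 : ∀ᵐ x ∂muI, x ≠ sSup E := by
      refine ae_restrict_of_ae ?_
      simp [ae_iff]
    filter_upwards [ae_mem_Ioo, h1] with s hs hne
    have hbd : BddAbove E := ⟨1, fun x hx => hx.2.2.le⟩
    refine propext ⟨fun h => ⟨hs.1, lt_of_le_of_ne (le_csSup hbd ⟨h, hs⟩) hne⟩, fun h => ?_⟩
    have hEne : E.Nonempty := by
      by_contra hne
      rw [not_nonempty_iff_eq_empty] at hne
      rw [hne, Real.sSup_empty] at h
      exact absurd h.2 (not_lt.2 hs.1.le)
    obtain ⟨x, hx, hsx⟩ := exists_lt_of_lt_csSup hEne h.2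
    exact lt_of_lt_of_le hx.1 (hk hs hx.2 hsx.le)
  rw [measure_congr ((withDensity_absolutelyContinuous muI u).ae_eq hE),
    measure_congr ((withDensity_absolutelyContinuous muI v).ae_eq hE),
    withDensity_apply _ measurableSet_Ioo, withDensity_apply _ measurableSet_Ioo]
  by_cases h0 : 0 < sSup E
  · refine h _ h0 (csSup_le ?_ fun x hx => hx.2.2.le)
    by_contra hne
    rw [not_nonempty_iff_eq_empty] at hne
    simp [hne] at h0
  · rw [Ioo_eq_empty (by simpa using h0)]
    simp

theorem rearrangement_smul {f : ℝ → ℝ} {a : ℝ} (ha : 0 < a) (t : ℝ) :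
    rearrangement (fun x => a * f x) t = a * rearrangement f t := by
  have hd : ∀ l, distribution (fun x => a * f x) l = distribution f (l / a) := by
    intro l
    simp only [distribution, abs_mul, abs_of_pos ha, div_lt_iff₀' ha]
  unfold rearrangement
  rw [← smul_eq_mul, ← Real.sInf_smul_of_nonneg ha.le]
  congr 1
  ext l
  simp only [hd, mem_ofPred_eq, mem_smul_set, smul_eq_mul]
  constructor
  · rintro ⟨h1, h2⟩
    exact ⟨l / a, ⟨by positivity, h2⟩, by field_simp⟩
  · rintro ⟨m, ⟨h1, h2⟩, rfl⟩
    refine ⟨by positivity, ?_⟩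
    rwa [mul_div_cancel_left₀ _ ha.ne']

theorem rearrangement_eq_zero {f : ℝ → ℝ} (hf : ∀ᵐ x ∂muI, f x = 0) (t : ℝ) :
    rearrangement f t = 0 := by
  refine le_antisymm (rearrangement_le le_rfl ?_) (rearrangement_nonneg _ _)
  have : distribution f 0 = 0 := by
    refine measure_mono_null (t := {x | ¬ f x = 0}) (fun x hx => ?_) hf
    exact abs_pos.1 hx
  rw [this]; exact zero_le

theorem tendsto_rearrangement {f : ℕ → ℝ → ℝ} {g : ℝ → ℝ} (hf : ∀ n, MemMPlus (f n))
    (hg : MemMPlus g)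
    (h : ∀ᵐ x ∂muI, Monotone (fun n => f n x) ∧ Tendsto (fun n => f n x) atTop (𝓝 (g x)))
    {t : ℝ} (ht : 0 < t) :
    Monotone (fun n => rearrangement (f n) t) ∧
      Tendsto (fun n => rearrangement (f n) t) atTop (𝓝 (rearrangement g t)) := by
  have hpos : ∀ᵐ x ∂muI, ∀ n, 0 ≤ f n x := ae_all_iff.2 fun n => (hf n).2
  have hle : ∀ n, ∀ᵐ x ∂muI, |f n x| ≤ |g x| := by
    intro n
    filter_upwards [h, hpos] with x hx hp
    have := hx.1.ge_of_tendsto hx.2 n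
    rw [abs_of_nonneg (hp n)]
    exact this.trans (le_abs_self _)
  have hmono : Monotone (fun n => rearrangement (f n) t) := by
    intro m n hmn
    refine rearrangement_mono (hf n).1 (fun l _ => distribution_mono ?_ l) ht
    filter_upwards [h, hpos] with x hx hp
    rw [abs_of_nonneg (hp n), abs_of_nonneg (hp m)]
    exact hx.1 hmn
  have hle' : ∀ n, rearrangement (f n) t ≤ rearrangement g t := fun n =>
    rearrangement_mono hg.1 (fun l _ => distribution_mono (hle n) l) ht
  have hbdd : BddAbove (range fun n => rearrangement (f n) t) :=
    ⟨_, by rintro _ ⟨n, rfl⟩; exact hle' n⟩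
  refine ⟨hmono, ?_⟩
  have ht1 := tendsto_atTop_ciSup hmono hbdd
  convert ht1
  refine le_antisymm ?_ (ciSup_le hle')
  set L := ⨆ n, rearrangement (f n) t
  have hL : 0 ≤ L := (rearrangement_nonneg (f 0) t).trans (le_ciSup hbdd 0)
  refine rearrangement_le hL ?_
  have hn : ∀ n, distribution (f n) L ≤ ENNReal.ofReal t := fun n =>
    (rearrangement_le_iff (hf n).1 ht hL).1 (le_ciSup hbdd n)
  -- Where `g > L`, eventually `f n > L`. Requiring this for all later indices makes the sets
  -- increasing, so the measure of the union is the supremum of measures bounded by `t`.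
  have hU : distribution g L ≤ muI (⋃ n : ℕ, {x | L < f n x ∧ ∀ m, n ≤ m → L < f m x}) := by
    refine measure_mono_ae ?_
    filter_upwards [h, hg.2] with x hx hg0 hl
    have hl : L < |g x| := hl
    rw [abs_of_nonneg hg0] at hl
    obtain ⟨n, hn⟩ := eventually_atTop.1 (hx.2.eventually (lt_mem_nhds hl))
    exact mem_iUnion.2 ⟨n, hn n le_rfl, hn⟩
  refine hU.trans ?_
  rw [Monotone.measure_iUnion]
  · refine iSup_le fun n => le_trans (measure_mono fun x hx => ?_) (hn n)
    exact lt_of_lt_of_le hx.1 (le_abs_self _)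
  · intro m n hmn x hx
    exact ⟨hx.2 n hmn, fun k hk => hx.2 k (hmn.trans hk)⟩

/-! ### Comparison of rearrangement-invariant norms -/

theorem MemM.memMPlus_abs {f : ℝ → ℝ} (hf : MemM f) : MemMPlus (fun x => |f x|) :=
  ⟨hf.abs, ae_of_all _ fun _ => abs_nonneg _⟩

theorem IsRINorm.congr {ρ : (ℝ → ℝ) → ℝ≥0∞} (hρ : IsRINorm ρ) {f g : ℝ → ℝ} (hf : MemMPlus f)
    (hg : MemMPlus g) (h : f =ᵐ[muI] g) : ρ f = ρ g :=
  le_antisymm (hρ.mono f g hf hg h.le) (hρ.mono g f hg hf h.symm.le)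

theorem IsRINorm.riNorm_eq_rearrangement {ρ : (ℝ → ℝ) → ℝ≥0∞} (hρ : IsRINorm ρ) {f : ℝ → ℝ}
    (hf : MemM f) : riNorm ρ f = ρ (rearrangement f) := by
  rw [riNorm, hρ.rearrangement_eq _ hf.memMPlus_abs]
  congr 1
  exact funext (rearrangement_abs f)

theorem IsRINorm.riNorm_eq {ρ : (ℝ → ℝ) → ℝ≥0∞} (hρ : IsRINorm ρ) {f : ℝ → ℝ}
    (hf : MemMPlus f) : riNorm ρ f = ρ f :=
  hρ.congr (MemM.memMPlus_abs hf.1) hf (hf.2.mono fun _ hx => abs_of_nonneg hx)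

theorem memMPlus_sum {g : ℕ → ℝ → ℝ} (hg : ∀ n, MemMPlus (g n)) (N : ℕ) :
    MemMPlus (fun x => ∑ n ∈ Finset.range N, g n x) := by
  refine ⟨Finset.aemeasurable_fun_sum _ fun n _ => (hg n).1, ?_⟩
  filter_upwards [ae_all_iff.2 fun n => (hg n).2] with x hx
  exact Finset.sum_nonneg fun n _ => hx n

theorem IsRINorm.sum_le {ρ : (ℝ → ℝ) → ℝ≥0∞} (hρ : IsRINorm ρ) {g : ℕ → ℝ → ℝ}
    (hg : ∀ n, MemMPlus (g n)) (N : ℕ) :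
    ρ (fun x => ∑ n ∈ Finset.range N, g n x) ≤ ∑ n ∈ Finset.range N, ρ (g n) := by
  induction N with
  | zero =>
    have h0 : MemMPlus (fun _ : ℝ => (0 : ℝ)) := ⟨aemeasurable_const, ae_of_all _ fun _ => le_rfl⟩
    simp only [Finset.range_zero, Finset.sum_empty, nonpos_iff_eq_zero]
    exact (hρ.eq_zero_iff _ h0).2 (ae_of_all _ fun _ => rfl)
  | succ N ih =>
    simp only [Finset.sum_range_succ]
    exact (hρ.add_le _ _ (memMPlus_sum hg N) (hg N)).trans (by gcongr)

/-- An absolutely convergent series in a rearrangement-invariant space converges to an element of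
the space that dominates its terms. -/
theorem IsRINorm.exists_sum {ρ : (ℝ → ℝ) → ℝ≥0∞} (hρ : IsRINorm ρ) {g : ℕ → ℝ → ℝ}
    (hg : ∀ n, MemMPlus (g n)) (hs : ∑' n, ρ (g n) < ∞) :
    ∃ G, MemMPlus G ∧ ρ G < ∞ ∧ ∀ n, ∀ᵐ x ∂muI, g n x ≤ G x := by
  obtain ⟨C, hC⟩ := hρ.lintegral_le
  -- The embedding into `L¹` makes the series finite almost everywhere, so its sum is a real-valued
  -- function.
  have hint : ∫⁻ x, ∑' n, ENNReal.ofReal (g n x) ∂muI ≠ ∞ := by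
    rw [lintegral_tsum fun n => (hg n).1.ennreal_ofReal]
    refine ne_top_of_le_ne_top ?_ (ENNReal.tsum_le_tsum fun n => hC (g n) (hg n))
    rw [ENNReal.tsum_mul_left]
    exact ENNReal.mul_ne_top ENNReal.coe_ne_top hs.ne
  have hpos : ∀ᵐ x ∂muI, ∀ n, 0 ≤ g n x := ae_all_iff.2 fun n => (hg n).2
  have hsum : ∀ᵐ x ∂muI, Summable fun n => g n x := by
    have := ae_lt_top' (AEMeasurable.tsum fun n => (hg n).1.ennreal_ofReal) hint
    filter_upwards [this, hpos] with x hx hp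
    have := ENNReal.summable_toReal hx.ne
    simpa only [ENNReal.toReal_ofReal (hp _)] using this
  have hG : ∀ᵐ x ∂muI, Monotone (fun N => ∑ n ∈ Finset.range N, g n x) ∧
      Tendsto (fun N => ∑ n ∈ Finset.range N, g n x) atTop (𝓝 (∑' n, g n x)) := by
    filter_upwards [hsum, hpos] with x hx hp
    refine ⟨monotone_nat_of_le_succ fun N => ?_, hx.hasSum.tendsto_sum_nat⟩
    rw [Finset.sum_range_succ]
    exact le_add_of_nonneg_right (hp N)
  have hGm : MemMPlus (fun x => ∑' n, g n x) := by
    refine ⟨aemeasurable_of_tendsto_metrizable_ae atTop (fun N => (memMPlus_sum hg N).1)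
      (hG.mono fun x hx => hx.2), ?_⟩
    filter_upwards [hpos] with x hp using tsum_nonneg hp
  refine ⟨_, hGm, ?_, fun n => ?_⟩
  · have ht := hρ.fatou _ _ (memMPlus_sum hg) hGm hG
    refine lt_of_le_of_lt (le_of_tendsto' ht fun N => ?_) hs
    exact (hρ.sum_le hg N).trans (ENNReal.sum_le_tsum _)
  · filter_upwards [hsum, hpos] with x hx hp
    exact hx.le_tsum n fun m _ => hp m

/-- An inclusion between rearrangement-invariant spaces is continuous. -/
theorem IsRINorm.exists_le_mul {ρ σ : (ℝ → ℝ) → ℝ≥0∞} (hρ : IsRINorm ρ) (hσ : IsRINorm σ)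
    (h : ∀ f, MemM f → riNorm ρ f < ∞ → riNorm σ f < ∞) :
    ∃ C : ℝ≥0, ∀ f, MemMPlus f → σ f ≤ C * ρ f := by
  by_contra! hcon
  -- Violators of the bound with constant `n 2 ^ n`, rescaled to have `ρ`-norm `2 ^ (-n)`; the sum
  -- of the series will lie in the first space but not in the second.
  have key : ∀ n : ℕ, ∃ g, MemMPlus g ∧ ρ g ≤ 2⁻¹ ^ n ∧ (n : ℝ≥0∞) ≤ σ g := by
    intro n
    obtain ⟨f, hf, hlt⟩ := hcon ((n : ℝ≥0) * 2 ^ n)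
    have h0 : ρ f ≠ 0 := by
      intro h0
      rw [(hσ.eq_zero_iff f hf).2 ((hρ.eq_zero_iff f hf).1 h0)] at hlt
      simp at hlt
    -- With constant `0` the violated bound does not exclude `ρ f = ∞`, because `0 * ∞ = 0`.
    by_cases hn : n = 0
    · subst hn
      refine ⟨fun _ => 0, ⟨aemeasurable_const, ae_of_all _ fun _ => le_rfl⟩, ?_, by simp⟩
      rw [(hρ.eq_zero_iff _ ⟨aemeasurable_const, ae_of_all _ fun _ => le_rfl⟩).2
        (ae_of_all _ fun _ => rfl)]
      simp
    have htop : ρ f ≠ ∞ := by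
      intro htop
      rw [htop, ENNReal.mul_top] at hlt
      · exact not_top_lt hlt
      · simp [hn]
    have hc : 0 < (ρ f).toReal := ENNReal.toReal_pos h0 htop
    set c : ℝ := (2 ^ n * (ρ f).toReal)⁻¹ with hcdef
    have hc0 : 0 ≤ c := by positivity
    have hcE : ENNReal.ofReal c = (2 ^ n * ρ f)⁻¹ := by
      rw [hcdef, ENNReal.ofReal_inv_of_pos (by positivity), ENNReal.ofReal_mul (by positivity),
        ENNReal.ofReal_toReal htop, ENNReal.ofReal_pow (by norm_num)]
      simp
    have h2n : (2 : ℝ≥0∞) ^ n ≠ 0 := by positivity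
    have h2t : (2 : ℝ≥0∞) ^ n ≠ ∞ := by finiteness
    have hm0 : (2 : ℝ≥0∞) ^ n * ρ f ≠ 0 := mul_ne_zero h2n h0
    have hmt : (2 : ℝ≥0∞) ^ n * ρ f ≠ ∞ := ENNReal.mul_ne_top h2t htop
    refine ⟨fun x => c * f x, ⟨hf.1.const_mul c, hf.2.mono fun x hx => mul_nonneg hc0 hx⟩, ?_, ?_⟩
    · rw [hρ.smul f hf c hc0, hcE, ENNReal.mul_inv (Or.inl h2n) (Or.inl h2t), mul_assoc,
        ENNReal.inv_mul_cancel h0 htop, mul_one, ENNReal.inv_pow]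
    · rw [hσ.smul f hf c hc0, hcE, mul_comm, ← div_eq_mul_inv, ENNReal.le_div_iff_mul_le
        (Or.inl hm0) (Or.inl hmt), ← mul_assoc]
      simpa using hlt.le
  choose g hg hρg hσg using key
  have hs : ∑' n, ρ (g n) < ∞ := by
    refine lt_of_le_of_lt (ENNReal.tsum_le_tsum hρg) ?_
    rw [ENNReal.tsum_geometric, ENNReal.one_sub_inv_two, inv_inv]
    exact ENNReal.ofNat_lt_top
  obtain ⟨G, hG, hGt, hle⟩ := hρ.exists_sum hg hs
  have hfin := h G hG.1 (by rwa [hρ.riNorm_eq hG])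
  rw [hσ.riNorm_eq hG] at hfin
  obtain ⟨n, hn⟩ := ENNReal.exists_nat_gt hfin.ne
  exact absurd (hn.trans_le (hσg n)) (not_lt.2 (hσ.mono _ _ (hg n) hG (hle n)))

/-! ### The optimal norm -/

/-- The kernel `min (τ^(α-1), s^(α-1))`. -/
noncomputable def kern (α τ s : ℝ) : ℝ := min (τ ^ (α - 1)) (s ^ (α - 1))

theorem kern_nonneg (α : ℝ) {τ s : ℝ} (hτ : 0 < τ) (hs : 0 < s) : 0 ≤ kern α τ s := by
  unfold kern; positivity

theorem kern_antitoneOn {α : ℝ} (hα : α < 1) (τ : ℝ) : AntitoneOn (kern α τ) (Ioo 0 1) :=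
  fun _ hs _ _ hst => min_le_min le_rfl (Real.rpow_le_rpow_of_nonpos hs.1 hst (by linarith))

theorem one_le_kern {α : ℝ} (hα : α < 1) {τ s : ℝ} (hτ : τ ∈ Ioo (0 : ℝ) 1)
    (hs : s ∈ Ioo (0 : ℝ) 1) : 1 ≤ kern α τ s :=
  le_min (Real.one_le_rpow_of_pos_of_le_one_of_nonpos hτ.1 hτ.2.le (by linarith))
    (Real.one_le_rpow_of_pos_of_le_one_of_nonpos hs.1 hs.2.le (by linarith))

theorem kern_of_le {α : ℝ} (hα : α < 1) {τ s : ℝ} (hτ : 0 < τ) (h : τ ≤ s) :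
    kern α τ s = s ^ (α - 1) :=
  min_eq_right (Real.rpow_le_rpow_of_nonpos hτ h (by linarith))

theorem kern_of_ge {α : ℝ} (hα : α < 1) {τ s : ℝ} (hs : 0 < s) (h : s ≤ τ) :
    kern α τ s = τ ^ (α - 1) :=
  min_eq_left (Real.rpow_le_rpow_of_nonpos hs h (by linarith))

theorem measurable_kern (α τ : ℝ) : Measurable (kern α τ) := by
  unfold kern; fun_prop

/-- The pairing of the rearrangement of `f` with the kernel. -/
noncomputable def pairing (α τ : ℝ) (f : ℝ → ℝ) : ℝ≥0∞ :=
  ∫⁻ s, ENNReal.ofReal (rearrangement f s) * ENNReal.ofReal (kern α τ s) ∂muI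

/-- The norm `sup_τ ψ(τ) ∫ f^* min (τ^(α-1), s^(α-1)) ds`. -/
noncomputable def optimalNorm (α : ℝ) (ψ : ℝ → ℝ) (f : ℝ → ℝ) : ℝ≥0∞ :=
  ⨆ τ ∈ Ioo (0 : ℝ) 1, ENNReal.ofReal (ψ τ) * pairing α τ f

/-- A positive, bounded, nondecreasing function on `(0,1)`. -/
structure IsWeight (ψ : ℝ → ℝ) : Prop where
  pos : ∀ t ∈ Ioo (0 : ℝ) 1, 0 < ψ t
  mono : MonotoneOn ψ (Ioo 0 1)
  bdd : ∃ M, 0 < M ∧ ∀ t ∈ Ioo (0 : ℝ) 1, ψ t ≤ M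

theorem rpow_mem_Ioo {t b : ℝ} (ht : t ∈ Ioo (0 : ℝ) 1) (hb : 0 < b) : t ^ b ∈ Ioo (0 : ℝ) 1 :=
  ⟨Real.rpow_pos_of_pos ht.1 _, Real.rpow_lt_one ht.1.le ht.2 hb⟩

/-- Boundedness comes from `φ t / t` being nonincreasing: for `u ≥ 1/2` one has `φ u ≤ 2 u φ (1/2)`.
Positivity, monotonicity and boundedness of `ψ` are all that the estimates of the optimal norm
require. -/
theorem IsQuasiconcave.isWeight {φ : ℝ → ℝ} (hφ : IsQuasiconcave φ) {β : ℝ} (hβ : 0 < β) :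
    IsWeight (fun τ => φ (τ ^ (1 / β))) := by
  have hb : 0 < 1 / β := by positivity
  refine ⟨fun t ht => hφ.pos _ (rpow_mem_Ioo ht hb), fun s hs t ht hst =>
    hφ.mono (rpow_mem_Ioo hs hb) (rpow_mem_Ioo ht hb) (Real.rpow_le_rpow hs.1.le hst hb.le),
    2 * φ (1 / 2), ?_, fun t ht => ?_⟩
  · have := hφ.pos (1 / 2) (by constructor <;> norm_num)
    positivity
  have hh : (1 / 2 : ℝ) ∈ Ioo (0 : ℝ) 1 := by constructor <;> norm_num
  have hu := rpow_mem_Ioo ht hb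
  generalize t ^ (1 / β) = u at hu
  have hp := hφ.pos _ hh
  rcases le_total u (1 / 2) with h | h
  · linarith [hφ.mono hu hh h]
  · have := hφ.anti hh hu h
    simp only at this
    rw [div_le_iff₀ hu.1] at this
    nlinarith [hu.2]

theorem pairing_mono {α τ : ℝ} {f g : ℝ → ℝ}
    (h : ∀ s, 0 < s → rearrangement f s ≤ rearrangement g s) : pairing α τ f ≤ pairing α τ g := by
  refine lintegral_mono_ae ?_
  filter_upwards [ae_mem_Ioo] with s hs
  gcongr
  exact h s hs.1

theorem optimalNorm_mono {α : ℝ} {ψ : ℝ → ℝ} {f g : ℝ → ℝ}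
    (h : ∀ s, 0 < s → rearrangement f s ≤ rearrangement g s) :
    optimalNorm α ψ f ≤ optimalNorm α ψ g :=
  iSup₂_mono fun _ _ => by gcongr; exact pairing_mono h

theorem lintegral_abs_mul_kern_le {α : ℝ} (hα : α < 1) {τ : ℝ} (hτ : 0 < τ) {f : ℝ → ℝ}
    (hf : MemM f) :
    ∫⁻ s, ENNReal.ofReal |f s| * ENNReal.ofReal (kern α τ s) ∂muI ≤ pairing α τ f :=
  lintegral_mul_antitone_le hf.abs.ennreal_ofReal (memM_rearrangement hf).ennreal_ofReal
    (fun _ hs => kern_nonneg α hτ hs.1) (kern_antitoneOn hα τ)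
    fun _ ht0 ht => setLIntegral_abs_le_rearrangement hf ht0 ht

theorem lintegral_abs_le_pairing {α : ℝ} (hα : α < 1) {τ : ℝ} (hτ : τ ∈ Ioo (0 : ℝ) 1)
    {f : ℝ → ℝ} (hf : MemM f) : ∫⁻ s, ENNReal.ofReal |f s| ∂muI ≤ pairing α τ f := by
  rw [← lintegral_rearrangement hf]
  refine lintegral_mono_ae ?_
  filter_upwards [ae_mem_Ioo] with s hs
  exact le_mul_of_one_le_right' (by simpa using one_le_kern hα hτ hs)

theorem lintegral_rpow_Ioo {α : ℝ} (hα : 0 < α) {t : ℝ} (ht : 0 ≤ t) :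
    ∫⁻ s in Ioo 0 t, ENNReal.ofReal (s ^ (α - 1)) = ENNReal.ofReal (t ^ α / α) := by
  have hi : IntegrableOn (fun s : ℝ => s ^ (α - 1)) (Ioo 0 t) := by
    have := intervalIntegral.intervalIntegrable_rpow' (a := 0) (b := t) (r := α - 1) (by linarith)
    rw [intervalIntegrable_iff_integrableOn_Ioo_of_le ht] at this
    exact this
  rw [← ofReal_integral_eq_lintegral_ofReal hi]
  · rw [← integral_Ioc_eq_integral_Ioo, ← intervalIntegral.integral_of_le ht,
      integral_rpow (Or.inl (by linarith))]
    simp [Real.zero_rpow hα.ne']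
  · exact (ae_restrict_iff' measurableSet_Ioo).2
      (ae_of_all _ fun s hs => Real.rpow_nonneg hs.1.le _)

/-- For each `τ` the triangle inequality is Hardy's lemma against the nonincreasing kernel, and
suprema preserve it. The kernel is at least `1`, which gives the embedding into `L¹`; it is at most
`s ^ (α - 1)`, integrable as `α > 0`, which together with boundedness of `ψ` makes the norm of `1`
finite. -/
theorem isRINorm_optimalNorm {α : ℝ} (hα0 : 0 < α) (hα1 : α < 1) {ψ : ℝ → ℝ} (hψ : IsWeight ψ) :
    IsRINorm (optimalNorm α ψ) := by
  have hh : (1 / 2 : ℝ) ∈ Ioo (0 : ℝ) 1 := by constructor <;> norm_num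
  have hψh := hψ.pos _ hh
  have hL1 : ∀ f, MemMPlus f → ∫⁻ x, ENNReal.ofReal (f x) ∂muI
      ≤ ((ψ (1 / 2))⁻¹.toNNReal : ℝ≥0∞) * optimalNorm α ψ f := by
    intro f hf
    have h1 : ∫⁻ x, ENNReal.ofReal (f x) ∂muI ≤ pairing α (1 / 2) f :=
      (lintegral_mono fun x => ENNReal.ofReal_le_ofReal (le_abs_self _)).trans
        (lintegral_abs_le_pairing hα1 hh hf.1)
    have h2 : ENNReal.ofReal (ψ (1 / 2)) * pairing α (1 / 2) f ≤ optimalNorm α ψ f :=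
      le_iSup₂ (f := fun τ (_ : τ ∈ Ioo (0 : ℝ) 1) => ENNReal.ofReal (ψ τ) * pairing α τ f) _ hh
    refine h1.trans ?_
    calc pairing α (1 / 2) f
        = ENNReal.ofReal (ψ (1 / 2))⁻¹ * (ENNReal.ofReal (ψ (1 / 2)) * pairing α (1 / 2) f) := by
          rw [← mul_assoc, ← ENNReal.ofReal_mul (by positivity), inv_mul_cancel₀ hψh.ne']
          simp
      _ ≤ _ := by gcongr; exact le_rfl
  have hzero : ∀ f, (f =ᵐ[muI] 0) → optimalNorm α ψ f = 0 := by
    intro f hf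
    simp only [optimalNorm, pairing, rearrangement_eq_zero hf]
    simp
  constructor
  · intro f hf
    refine ⟨fun h => ?_, hzero f⟩
    have := hL1 f hf
    rw [h, mul_zero, nonpos_iff_eq_zero, lintegral_eq_zero_iff' hf.1.ennreal_ofReal] at this
    filter_upwards [this, hf.2] with x hx hx0
    exact le_antisymm (ENNReal.ofReal_eq_zero.1 hx) hx0
  · intro f hf a ha
    rcases ha.eq_or_lt with rfl | ha
    · rw [hzero]
      · simp
      · exact ae_of_all _ fun _ => by simp
    · simp only [optimalNorm, pairing, rearrangement_smul ha, ENNReal.mul_iSup]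
      refine iSup_congr fun τ => iSup_congr fun _ => ?_
      rw [mul_left_comm, ← lintegral_const_mul' (ENNReal.ofReal a) _ ENNReal.ofReal_ne_top]
      congr 1
      refine lintegral_congr fun s => ?_
      rw [ENNReal.ofReal_mul ha.le, mul_assoc]
  · intro f g hf hg
    refine iSup₂_le fun τ hτ => ?_
    have h1 : pairing α τ (fun x => f x + g x) ≤ pairing α τ f + pairing α τ g := by
      have hfm := (memM_rearrangement hf.1).ennreal_ofReal
      have hgm := (memM_rearrangement hg.1).ennreal_ofReal
      have hk := (measurable_kern α τ).ennreal_ofReal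
      have hadd := lintegral_add_left' (hfm.mul hk.aemeasurable)
        (fun s => ENNReal.ofReal (rearrangement g s) * ENNReal.ofReal (kern α τ s))
      simp only [Pi.mul_apply, ← add_mul] at hadd
      rw [pairing, pairing, pairing, ← hadd]
      exact lintegral_mul_antitone_le (memM_rearrangement (hf.1.add hg.1)).ennreal_ofReal
        (hfm.add hgm) (fun _ hs => kern_nonneg α hτ.1 hs.1) (kern_antitoneOn hα1 τ)
        fun _ ht0 ht => setLIntegral_rearrangement_add_le hf.1 hg.1 ht0 ht
    calc _ ≤ ENNReal.ofReal (ψ τ) * (pairing α τ f + pairing α τ g) := by gcongr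
      _ = ENNReal.ofReal (ψ τ) * pairing α τ f + ENNReal.ofReal (ψ τ) * pairing α τ g := mul_add ..
      _ ≤ _ := add_le_add
        (le_iSup₂ (f := fun τ (_ : τ ∈ Ioo (0 : ℝ) 1) => ENNReal.ofReal (ψ τ) * pairing α τ f) _ hτ)
        (le_iSup₂ (f := fun τ (_ : τ ∈ Ioo (0 : ℝ) 1) => ENNReal.ofReal (ψ τ) * pairing α τ g) _ hτ)
  · intro f g hf hg h
    refine optimalNorm_mono fun s hs => rearrangement_mono hg.1
      (fun l _ => distribution_mono ?_ l) hs
    filter_upwards [h, hf.2, hg.2] with x hx h1 h2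
    rwa [abs_of_nonneg h1, abs_of_nonneg h2]
  · intro f g hf hg h
    have hr := fun s (hs : 0 < s) => tendsto_rearrangement hf hg h hs
    have hm : Monotone fun n => optimalNorm α ψ (f n) := fun m n hmn =>
      optimalNorm_mono fun s hs => (hr s hs).1 hmn
    have hp : ∀ τ, pairing α τ g = ⨆ n, pairing α τ (f n) := by
      intro τ
      refine (iSup_eq_of_tendsto (fun m n hmn => pairing_mono fun s hs => (hr s hs).1 hmn) ?_).symm
      refine lintegral_tendsto_of_tendsto_of_monotone (fun n =>
        (memM_rearrangement (hf n).1).ennreal_ofReal.mul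
          (measurable_kern α τ).ennreal_ofReal.aemeasurable) ?_ ?_
      · filter_upwards [ae_mem_Ioo] with s hs m n hmn
        have := (hr s hs.1).1 hmn
        dsimp only at this ⊢
        gcongr
      · filter_upwards [ae_mem_Ioo] with s hs
        exact ENNReal.Tendsto.mul_const (ENNReal.tendsto_ofReal (hr s hs.1).2)
          (Or.inr ENNReal.ofReal_ne_top)
    have : optimalNorm α ψ g = ⨆ n, optimalNorm α ψ (f n) := by
      simp only [optimalNorm, hp, ENNReal.mul_iSup]
      exact le_antisymm
        (iSup₂_le fun τ hτ => iSup_le fun n => le_iSup_of_le n (le_iSup₂_of_le τ hτ le_rfl))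
        (iSup_le fun n => iSup₂_le fun τ hτ => le_iSup₂_of_le τ hτ
          (le_iSup (fun n => ENNReal.ofReal (ψ τ) * pairing α τ (f n)) n))
    rw [this]
    exact tendsto_atTop_iSup hm
  · obtain ⟨M, hM0, hM⟩ := hψ.bdd
    refine lt_of_le_of_lt (iSup₂_le (a := ENNReal.ofReal M * ENNReal.ofReal (1 ^ α / α))
      fun τ hτ => ?_) (ENNReal.mul_lt_top ENNReal.ofReal_lt_top ENNReal.ofReal_lt_top)
    gcongr
    · exact hM τ hτ
    · rw [← lintegral_rpow_Ioo hα0 zero_le_one]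
      refine lintegral_mono fun s => ?_
      have h1 : rearrangement (fun _ => 1) s ≤ 1 := by
        refine rearrangement_le zero_le_one ?_
        simp [distribution]
      calc _ ≤ ENNReal.ofReal 1 * ENNReal.ofReal (s ^ (α - 1)) := by
            gcongr
            exact min_le_right _ _
        _ = _ := by simp
  · exact ⟨_, hL1⟩
  · intro f hf
    simp only [optimalNorm, pairing, rearrangement_rearrangement hf.1]

/-! ### The Hardy operator -/

/-- The Hardy operator applied to `|f|`, with values in `[0,∞]`. -/
noncomputable def hardyAbs (α β : ℝ) (f : ℝ → ℝ) (r : ℝ) : ℝ≥0∞ :=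
  ∫⁻ s in Ioo (r ^ β) 1, ENNReal.ofReal (|f s| * s ^ (α - 1))

theorem hardyAbs_anti {α β : ℝ} (hβ : 0 < β) (f : ℝ → ℝ) :
    AntitoneOn (hardyAbs α β f) (Ioo 0 1) := fun _ hr _ _ hrt =>
  lintegral_mono_set (Ioo_subset_Ioo_left (Real.rpow_le_rpow hr.1.le hrt hβ.le))

/-- Tonelli: the mass at `s` is counted for those `r < t` with `r ^ β < s`, that is `r < min t (s ^
(1 / β))`. -/
theorem setLIntegral_hardyAbs_le {α β : ℝ} (hβ : 0 < β) {f : ℝ → ℝ} (hf : MemM f) (t : ℝ) :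
    ∫⁻ r in Ioo 0 t, hardyAbs α β f r
      ≤ ∫⁻ s, ENNReal.ofReal (|f s| * s ^ (α - 1)) * ENNReal.ofReal (min t (s ^ (1 / β))) ∂muI := by
  set F : ℝ → ℝ≥0∞ := fun s => ENNReal.ofReal (|f s| * s ^ (α - 1))
  have hF : AEMeasurable F muI := by
    have : Measurable fun s : ℝ => s ^ (α - 1) := by fun_prop
    exact (hf.abs.mul this.aemeasurable).ennreal_ofReal
  have hset : MeasurableSet {p : ℝ × ℝ | p.1 ^ β < p.2} :=
    measurableSet_lt (by fun_prop) (by fun_prop)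
  have h1 : ∀ r ∈ Ioo 0 t, hardyAbs α β f r
      = ∫⁻ s, {p : ℝ × ℝ | p.1 ^ β < p.2}.indicator (fun p => F p.2) (r, s) ∂muI := by
    intro r hr
    have hs : Ioo (r ^ β) 1 = Ioi (r ^ β) ∩ Ioo 0 1 := by
      ext s
      simp only [mem_Ioo, mem_inter_iff, mem_Ioi]
      exact ⟨fun h => ⟨h.1, (Real.rpow_nonneg hr.1.le _).trans_lt h.1, h.2⟩,
        fun h => ⟨h.1, h.2.2⟩⟩
    rw [hardyAbs, hs, ← Measure.restrict_restrict measurableSet_Ioi,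
      ← lintegral_indicator measurableSet_Ioi]
    rfl
  rw [setLIntegral_congr_fun measurableSet_Ioo h1, lintegral_lintegral_swap]
  · refine lintegral_mono_ae ?_
    filter_upwards [ae_mem_Ioo] with s hs
    calc ∫⁻ r in Ioo 0 t, {p : ℝ × ℝ | p.1 ^ β < p.2}.indicator (fun p => F p.2) (r, s)
        ≤ ∫⁻ r in Ioo 0 t, (Ioo 0 (min t (s ^ (1 / β)))).indicator (fun _ => F s) r := by
          refine setLIntegral_mono' measurableSet_Ioo fun r hr => ?_
          by_cases h : r ^ β < s
          · have hrs : r < s ^ (1 / β) := by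
              rw [one_div]
              exact (Real.lt_rpow_inv_iff_of_pos hr.1.le hs.1.le hβ).2 h
            rw [indicator_of_mem (show r ∈ Ioo 0 (min t (s ^ (1 / β))) from
              ⟨hr.1, lt_min hr.2 hrs⟩)]
            exact indicator_le_self _ _ _
          · rw [indicator_of_notMem (by exact h)]
            exact zero_le
      _ ≤ ∫⁻ r, (Ioo 0 (min t (s ^ (1 / β)))).indicator (fun _ => F s) r :=
          lintegral_mono' Measure.restrict_le_self le_rfl
      _ = F s * ENNReal.ofReal (min t (s ^ (1 / β))) := by
          rw [lintegral_indicator measurableSet_Ioo, setLIntegral_const]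
          simp
  · have : AEMeasurable (fun p : ℝ × ℝ => F p.2) ((volume.restrict (Ioo 0 t)).prod muI) :=
      hF.comp_snd
    exact this.indicator hset

/-- `hardyAbs` is a nonincreasing majorant of `|H f|`, hence also a majorant of its rearrangement:
`|H f|` can exceed the value of `hardyAbs` at `r` only on `(0,r)`. -/
theorem hardyAverage_hardyOp_le {α β : ℝ} (hβ : 0 < β) {f : ℝ → ℝ}
    (hfin : ∀ t ∈ Ioo (0 : ℝ) 1, hardyAbs α β f t < ∞) {t : ℝ} (ht : t ∈ Ioo (0 : ℝ) 1) :
    hardyAverage (hardyOp α β f) t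
      ≤ (∫⁻ r in Ioo 0 t, hardyAbs α β f r) / ENNReal.ofReal t := by
  unfold hardyAverage
  gcongr 1
  refine setLIntegral_mono' measurableSet_Ioo fun r hr => ?_
  have hr1 : r ∈ Ioo (0 : ℝ) 1 := ⟨hr.1, hr.2.trans ht.2⟩
  rw [ENNReal.ofReal_le_iff_le_toReal (hfin r hr1).ne]
  refine rearrangement_le ENNReal.toReal_nonneg ?_
  rw [← muI_Ioo hr1.2.le]
  refine measure_mono_ae ?_
  filter_upwards [ae_mem_Ioo] with x hx hl
  refine ⟨hx.1, ?_⟩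
  by_contra hrx
  have h1 : |hardyOp α β f x| ≤ (hardyAbs α β f x).toReal := by
    rw [← Real.norm_eq_abs, hardyOp]
    refine (norm_integral_le_lintegral_norm _).trans_eq ?_
    congr 1
    refine setLIntegral_congr_fun measurableSet_Ioo fun s hs => ?_
    have hs0 : 0 < s := (Real.rpow_pos_of_pos hx.1 _).trans hs.1
    simp [abs_of_pos (Real.rpow_pos_of_pos hs0 _)]
  have h2 := ENNReal.toReal_mono (hfin r hr1).ne (hardyAbs_anti hβ f hr1 hx (not_lt.1 hrx))
  have hl : (hardyAbs α β f r).toReal < |hardyOp α β f x| := hl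
  linarith

theorem rpow_rpow_cancel {t β : ℝ} (ht : 0 ≤ t) (hβ : β ≠ 0) : (t ^ β) ^ (1 / β) = t := by
  rw [← Real.rpow_mul ht, mul_one_div_cancel hβ, Real.rpow_one]

theorem rpow_rpow_cancel' {t β : ℝ} (ht : 0 ≤ t) (hβ : β ≠ 0) : (t ^ (1 / β)) ^ β = t := by
  rw [← Real.rpow_mul ht, one_div_mul_cancel hβ, Real.rpow_one]

/-- The assumption `α + 1 / β ≥ 1` enters here: `s ^ (α - 1 + 1 / β)` is then nondecreasing, so for
`s ≤ t ^ β` it is at most its value at `t ^ β`. -/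
theorem rpow_mul_min_le {α β : ℝ} (hα : α < 1) (hβ : 0 < β) (hαβ : 1 ≤ α + 1 / β) {s t : ℝ}
    (hs : 0 < s) (ht : 0 < t) :
    s ^ (α - 1) * min t (s ^ (1 / β)) ≤ t * kern α (t ^ β) s := by
  have hp := Real.rpow_pos_of_pos hs (α - 1)
  rcases le_total (t ^ β) s with h | h
  · rw [kern_of_le hα (Real.rpow_pos_of_pos ht _) h, mul_comm]
    gcongr
    exact min_le_left _ _
  · rw [kern_of_ge hα hs h]
    calc s ^ (α - 1) * min t (s ^ (1 / β)) ≤ s ^ (α - 1) * s ^ (1 / β) := by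
          gcongr; exact min_le_right _ _
      _ = s ^ (α - 1 + 1 / β) := (Real.rpow_add hs _ _).symm
      _ ≤ (t ^ β) ^ (α - 1 + 1 / β) := by gcongr; linarith
      _ = t * (t ^ β) ^ (α - 1) := by
        rw [Real.rpow_add (Real.rpow_pos_of_pos ht _), rpow_rpow_cancel ht.le hβ.ne', mul_comm]

/-- A weighted pairing bound for `f ∈ N` implies that the Hardy operator maps `N` into the
Marcinkiewicz space. -/
theorem hardyBounded_of_pairing {α β : ℝ} (hα : α < 1) (hβ : 0 < β) (hαβ : 1 ≤ α + 1 / β)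
    {φ : ℝ → ℝ} (hφ : IsQuasiconcave φ) {N : (ℝ → ℝ) → ℝ≥0∞} {C : ℝ≥0}
    (h : ∀ f, MemM f → N f < ∞ → ∀ τ ∈ Ioo (0 : ℝ) 1, ENNReal.ofReal (φ (τ ^ (1 / β))) *
      ∫⁻ s, ENNReal.ofReal |f s| * ENNReal.ofReal (kern α τ s) ∂muI ≤ C * N f) :
    HardyBounded α β N (marcinkiewiczNorm φ) := by
  refine ⟨C, fun f hf hN => ?_⟩
  have hh := fun t (ht : t ∈ Ioo (0 : ℝ) 1) => h f hf hN (t ^ β) (rpow_mem_Ioo ht hβ)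
  have hCN : (C : ℝ≥0∞) * N f < ∞ := ENNReal.mul_lt_top ENNReal.coe_lt_top hN
  have hfin : ∀ t ∈ Ioo (0 : ℝ) 1, hardyAbs α β f t < ∞ := by
    intro t ht
    have h1 : ∫⁻ s, ENNReal.ofReal |f s| * ENNReal.ofReal (kern α (t ^ β) s) ∂muI < ∞ := by
      refine ENNReal.lt_top_of_mul_ne_top_right ((hh t ht).trans_lt hCN).ne ?_
      rw [rpow_rpow_cancel ht.1.le hβ.ne']
      exact (ENNReal.ofReal_pos.2 (hφ.pos t ht)).ne'
    refine lt_of_le_of_lt ?_ h1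
    have hu : 0 < t ^ β := Real.rpow_pos_of_pos ht.1 _
    refine le_trans ?_ (lintegral_mono_set (Ioo_subset_Ioo_left hu.le))
    refine setLIntegral_mono' measurableSet_Ioo fun s hs => ?_
    rw [← ENNReal.ofReal_mul (abs_nonneg _), kern_of_le hα hu hs.1.le]
  refine ⟨fun t ht => ?_, ?_⟩
  · have hu : 0 < t ^ β := Real.rpow_pos_of_pos ht.1 _
    have hle : volume.restrict (Ioo (t ^ β) 1) ≤ muI :=
      Measure.restrict_mono (Ioo_subset_Ioo_left hu.le) le_rfl
    have hm : Measurable fun s : ℝ => s ^ (α - 1) := by fun_prop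
    refine ⟨((AEMeasurable.mono_measure hf hle).mul hm.aemeasurable).aestronglyMeasurable, ?_⟩
    rw [hasFiniteIntegral_iff_norm]
    refine lt_of_eq_of_lt ?_ (hfin t ht)
    refine setLIntegral_congr_fun measurableSet_Ioo fun s hs => ?_
    have hs0 : 0 < s := hu.trans hs.1
    simp only [norm_mul, Real.norm_eq_abs, abs_of_pos (Real.rpow_pos_of_pos hs0 _)]
  · refine iSup₂_le fun t ht => le_trans ?_ (hh t ht)
    rw [rpow_rpow_cancel ht.1.le hβ.ne', mul_comm]
    gcongr
    refine (hardyAverage_hardyOp_le hβ hfin ht).trans (ENNReal.div_le_of_le_mul ?_)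
    refine (setLIntegral_hardyAbs_le hβ hf t).trans ?_
    rw [mul_comm, ← lintegral_const_mul' _ _ ENNReal.ofReal_ne_top]
    refine lintegral_mono_ae ?_
    filter_upwards [ae_mem_Ioo] with s hs
    have hk := kern_nonneg α (Real.rpow_pos_of_pos ht.1 β) hs.1
    have hp := Real.rpow_pos_of_pos hs.1 (α - 1)
    rw [← ENNReal.ofReal_mul (by positivity), ← ENNReal.ofReal_mul (by positivity),
      ← ENNReal.ofReal_mul ht.1.le]
    refine ENNReal.ofReal_le_ofReal ?_
    calc |f s| * s ^ (α - 1) * min t (s ^ (1 / β))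
        = |f s| * (s ^ (α - 1) * min t (s ^ (1 / β))) := by ring
      _ ≤ |f s| * (t * kern α (t ^ β) s) := by
        gcongr |f s| * ?_
        exact rpow_mul_min_le hα hβ hαβ hs.1 ht.1
      _ = _ := by ring

/-- Lower bound for the Marcinkiewicz norm of the Hardy operator at nonnegative functions. -/
theorem ofReal_mul_hardyOp_le {α β : ℝ} (hβ : 0 < β) {φ : ℝ → ℝ} {f : ℝ → ℝ}
    (hf : ∀ᵐ s ∂muI, 0 ≤ f s)
    (hi : ∀ t ∈ Ioo (0 : ℝ) 1, IntegrableOn (fun s => f s * s ^ (α - 1)) (Ioo (t ^ β) 1))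
    {t : ℝ} (ht : t ∈ Ioo (0 : ℝ) 1) :
    ENNReal.ofReal (φ t) * ∫⁻ s in Ioo (t ^ β) 1, ENNReal.ofReal (f s * s ^ (α - 1))
      ≤ marcinkiewiczNorm φ (hardyOp α β f) := by
  have hpos : ∀ r ∈ Ioo (0 : ℝ) 1,
      0 ≤ᵐ[volume.restrict (Ioo (r ^ β) 1)] fun s => f s * s ^ (α - 1) := by
    intro r hr
    have hu : 0 < r ^ β := Real.rpow_pos_of_pos hr.1 _
    have h1 := ae_restrict_of_ae_restrict_of_subset (Ioo_subset_Ioo_left hu.le) hf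
    filter_upwards [h1, ae_restrict_mem measurableSet_Ioo] with s hs hs1
    exact mul_nonneg hs (Real.rpow_nonneg (hu.trans hs1.1).le _)
  have hnn : ∀ r ∈ Ioo (0 : ℝ) 1, 0 ≤ hardyOp α β f r := fun r hr =>
    integral_nonneg_of_ae (hpos r hr)
  have hanti : AntitoneOn (hardyOp α β f) (Ioo 0 1) := fun r hr r' hr' hrr' =>
    setIntegral_mono_set (hi r hr) (hpos r hr)
      (Ioo_subset_Ioo_left (Real.rpow_le_rpow hr.1.le hrr' hβ.le)).eventuallyLE
  have hmem : MemM (hardyOp α β f) := aemeasurable_restrict_of_antitoneOn measurableSet_Ioo hanti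
  -- For `f ≥ 0` the image is nonincreasing, so its value at `t` is below its mean over `(0,t)`.
  have key : ENNReal.ofReal (hardyOp α β f t) ≤ hardyAverage (hardyOp α β f) t := by
    rw [hardyAverage, ENNReal.le_div_iff_mul_le (Or.inl (ENNReal.ofReal_pos.2 ht.1).ne')
      (Or.inl ENNReal.ofReal_ne_top)]
    rw [← setLIntegral_muI _ ht.2.le]
    refine le_trans ?_ (setLIntegral_abs_le_rearrangement hmem ht.1 ht.2.le)
    rw [← muI_Ioo ht.2.le, ← setLIntegral_const]
    refine setLIntegral_mono' measurableSet_Ioo fun s hs => ENNReal.ofReal_le_ofReal ?_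
    exact (hanti ⟨hs.1, hs.2.trans ht.2⟩ ht hs.2.le).trans (le_abs_self _)
  rw [← ofReal_integral_eq_lintegral_ofReal (hi t ht) (hpos t ht), mul_comm]
  refine le_trans ?_ (le_iSup₂ (f := fun t (_ : t ∈ Ioo (0 : ℝ) 1) =>
    hardyAverage (hardyOp α β f) t * ENNReal.ofReal (φ t)) t ht)
  gcongr
  exact key

/-! ### Optimality -/

theorem setLIntegral_comp_sub (w : ℝ → ℝ≥0∞) (τ a b : ℝ) :
    ∫⁻ s in Ioo (a + τ) (b + τ), w (s - τ) = ∫⁻ s in Ioo a b, w s := by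
  have := (measurePreserving_sub_right volume τ).setLIntegral_comp_preimage_emb
    (MeasurableEquiv.subRight τ).measurableEmbedding w (Ioo a b)
  rwa [preimage_sub_const_Ioo] at this

/-- The translate of `u` to the right by `τ`, cut off to `(τ,1)`. -/
noncomputable def shift (τ : ℝ) (u : ℝ → ℝ) : ℝ → ℝ :=
  (Ioo τ 1).indicator fun s => u (s - τ)

theorem distribution_shift_le {τ : ℝ} (hτ : 0 ≤ τ) (u : ℝ → ℝ) {l : ℝ} (hl : 0 ≤ l) :
    distribution (shift τ u) l ≤ distribution u l := by
  rw [distribution, distribution, muI, Measure.restrict_apply' measurableSet_Ioo,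
    Measure.restrict_apply' measurableSet_Ioo,
    ← (measurePreserving_sub_right volume τ).measure_preimage_emb
      (MeasurableEquiv.subRight τ).measurableEmbedding ({x | l < |u x|} ∩ Ioo 0 1)]
  refine measure_mono fun s hs => ?_
  have h1 : l < |shift τ u s| := hs.1
  by_cases h : s ∈ Ioo τ 1
  · rw [shift, indicator_of_mem h] at h1
    exact ⟨h1, sub_pos.2 h.1, by linarith [h.2]⟩
  · rw [shift, indicator_of_notMem h, abs_zero] at h1
    exact absurd h1 (not_lt.2 hl)

theorem memMPlus_shift {τ : ℝ} (hτ : τ ∈ Ioo (0 : ℝ) 1) {u : ℝ → ℝ} (hu : AntitoneOn u (Ioi 0))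
    (hu0 : ∀ s, 0 ≤ u s) : MemMPlus (shift τ u) := by
  refine ⟨?_, ae_of_all _ fun s => indicator_nonneg (fun _ _ => hu0 _) _⟩
  rw [shift, aemeasurable_indicator_iff measurableSet_Ioo, muI,
    Measure.restrict_restrict measurableSet_Ioo, inter_eq_left.2 (Ioo_subset_Ioo_left hτ.1.le)]
  exact aemeasurable_restrict_of_antitoneOn measurableSet_Ioo fun s hs t ht hst =>
    hu (sub_pos.2 hs.1) (sub_pos.2 ht.1) (by linarith)

/-- `s + τ ≤ 2 max s τ`, and `2 ^ (α - 1) ≥ 1/2`. This turns the kernel at `s` into the Hardy weight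
at the translated point `s + τ`. -/
theorem kern_le_rpow_add {α : ℝ} (hα0 : 0 < α) (hα : α < 1) {τ s : ℝ} (hτ : 0 < τ) (hs : 0 < s) :
    kern α τ s ≤ 2 * (s + τ) ^ (α - 1) := by
  have h2 : (1 / 2 : ℝ) ≤ 2 ^ (α - 1) := by
    rw [show (1 / 2 : ℝ) = 2 ^ (-1 : ℝ) by rw [Real.rpow_neg_one]; norm_num]
    exact Real.rpow_le_rpow_of_exponent_le (by norm_num) (by linarith)
  have key : ∀ m, 0 < m → s + τ ≤ 2 * m → m ^ (α - 1) ≤ 2 * (s + τ) ^ (α - 1) := by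
    intro m hm h
    have h1 := Real.rpow_le_rpow_of_nonpos (z := α - 1) (by linarith) h (by linarith)
    rw [Real.mul_rpow (by norm_num) hm.le] at h1
    have h3 := Real.rpow_pos_of_pos hm (α - 1)
    nlinarith
  rcases le_total τ s with h | h
  · exact (min_le_right _ _).trans (key s hs (by linarith))
  · exact (min_le_left _ _).trans (key τ hτ (by linarith))

theorem lintegral_Ioo_le_two_mul {w : ℝ → ℝ≥0∞} (hw : AntitoneOn w (Ioo 0 1)) :
    ∫⁻ s in Ioo 0 1, w s ≤ 2 * ∫⁻ s in Ioo 0 (1 / 2), w s := by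
  have hU : Ioo (0 : ℝ) 1 ⊆ Ioc 0 (1 / 2) ∪ Ioo (1 / 2) 1 := by
    intro s hs
    rcases le_or_gt s (1 / 2) with h | h
    · exact Or.inl ⟨hs.1, h⟩
    · exact Or.inr ⟨h, hs.2⟩
  calc ∫⁻ s in Ioo 0 1, w s ≤ ∫⁻ s in Ioc 0 (1 / 2) ∪ Ioo (1 / 2) 1, w s := lintegral_mono_set hU
    _ ≤ (∫⁻ s in Ioc 0 (1 / 2), w s) + ∫⁻ s in Ioo (1 / 2) 1, w s := lintegral_union_le _ _ _
    _ ≤ (∫⁻ s in Ioo 0 (1 / 2), w s) + ∫⁻ s in Ioo 0 (1 / 2), w s := by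
        rw [setLIntegral_congr (Ioo_ae_eq_Ioc (α := ℝ) (a := 0) (b := 1 / 2))]
        gcongr 1
        rw [← setLIntegral_congr (Ioo_ae_eq_Ioc (α := ℝ) (a := 0) (b := 1 / 2)),
          ← setLIntegral_comp_sub w (1 / 2) 0 (1 / 2)]
        norm_num only
        refine setLIntegral_mono' measurableSet_Ioo fun s hs => hw ⟨?_, ?_⟩ ⟨?_, ?_⟩ ?_ <;>
          linarith [hs.1, hs.2]
    _ = _ := (two_mul _).symm

/-- Optimality of the norm: the test function is `f^*` translated by `τ`, whose norm is at most that
of `f`. The constant `4` is one factor `2` for restricting to `(0,1/2)`, so that the translate stays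
inside `(0,1)`, and one from `kern_le_rpow_add`. -/
theorem IsRINorm.pairing_le {α β : ℝ} (hα0 : 0 < α) (hα : α < 1) (hβ : 0 < β) {φ : ℝ → ℝ}
    {σ : (ℝ → ℝ) → ℝ≥0∞} (hσ : IsRINorm σ) {C : ℝ≥0}
    (hC : ∀ f, MemM f → riNorm σ f < ∞ →
      (∀ t ∈ Ioo (0 : ℝ) 1, IntegrableOn (fun s => f s * s ^ (α - 1)) (Ioo (t ^ β) 1)) ∧
      marcinkiewiczNorm φ (hardyOp α β f) ≤ C * riNorm σ f)
    {f : ℝ → ℝ} (hf : MemM f) (hfin : riNorm σ f < ∞) {τ : ℝ} (hτ0 : 0 < τ) (hτ : τ ≤ 1 / 2) :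
    ENNReal.ofReal (φ (τ ^ (1 / β))) * pairing α τ f ≤ 4 * (C * riNorm σ f) := by
  have hτ1 : τ ∈ Ioo (0 : ℝ) 1 := ⟨hτ0, by linarith⟩
  set u := rearrangement f
  have huM := memMPlus_rearrangement hf
  have hanti : AntitoneOn u (Ioi 0) := rearrangement_antitoneOn hf
  have hu0 : ∀ s, 0 ≤ u s := rearrangement_nonneg f
  set v := shift τ u
  have hv : MemMPlus v := memMPlus_shift hτ1 hanti hu0
  have hvσ : riNorm σ v ≤ riNorm σ f := by
    rw [hσ.riNorm_eq_rearrangement hv.1, hσ.riNorm_eq_rearrangement hf]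
    refine hσ.mono _ _ (memMPlus_rearrangement hv.1) huM (ae_muI_of_forall fun s hs => ?_)
    refine rearrangement_mono hf (fun l hl => ?_) hs.1
    exact (distribution_shift_le hτ0.le u hl).trans_eq (distribution_rearrangement hf hl)
  obtain ⟨hi, hb⟩ := hC v hv.1 (hvσ.trans_lt hfin)
  have hlow := ofReal_mul_hardyOp_le hβ (φ := φ) hv.2 hi (rpow_mem_Ioo hτ1 (one_div_pos.2 hβ))
  rw [rpow_rpow_cancel' hτ0.le hβ.ne'] at hlow
  have hmain : pairing α τ f ≤ 4 * ∫⁻ s in Ioo τ 1, ENNReal.ofReal (v s * s ^ (α - 1)) := by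
    set w : ℝ → ℝ≥0∞ := fun s => ENNReal.ofReal (u s) * ENNReal.ofReal (kern α τ s)
    have hw : AntitoneOn w (Ioo 0 1) := fun s hs t ht hst =>
      mul_le_mul' (ENNReal.ofReal_le_ofReal (hanti hs.1 ht.1 hst))
        (ENNReal.ofReal_le_ofReal (kern_antitoneOn hα τ hs ht hst))
    refine (lintegral_Ioo_le_two_mul hw).trans ?_
    rw [show (4 : ℝ≥0∞) = 2 * 2 by norm_num, mul_assoc]
    refine mul_le_mul_right ?_ _
    rw [← setLIntegral_comp_sub w τ 0 (1 / 2),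
      ← lintegral_const_mul' _ _ (by finiteness), zero_add]
    refine (lintegral_mono_set (Ioo_subset_Ioo_right (show 1 / 2 + τ ≤ 1 by linarith))).trans ?_
    refine setLIntegral_mono' measurableSet_Ioo fun s hs => ?_
    have hs0 : 0 < s - τ := sub_pos.2 hs.1
    have h1 := kern_le_rpow_add hα0 hα hτ0 hs0
    rw [sub_add_cancel] at h1
    have hvs : v s = u (s - τ) := indicator_of_mem hs _
    have hws : w (s - τ) = ENNReal.ofReal (u (s - τ)) * ENNReal.ofReal (kern α τ (s - τ)) := rfl
    rw [hvs, hws, ← ENNReal.ofReal_mul (hu0 _), show (2 : ℝ≥0∞) = ENNReal.ofReal 2 by simp,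
      ← ENNReal.ofReal_mul (by norm_num)]
    refine ENNReal.ofReal_le_ofReal ?_
    calc u (s - τ) * kern α τ (s - τ) ≤ u (s - τ) * (2 * s ^ (α - 1)) := by
          gcongr
          exact hu0 _
      _ = _ := by ring
  calc ENNReal.ofReal (φ (τ ^ (1 / β))) * pairing α τ f
      ≤ ENNReal.ofReal (φ (τ ^ (1 / β))) *
        (4 * ∫⁻ s in Ioo τ 1, ENNReal.ofReal (v s * s ^ (α - 1))) := by gcongr
    _ = 4 * (ENNReal.ofReal (φ (τ ^ (1 / β))) *
        ∫⁻ s in Ioo τ 1, ENNReal.ofReal (v s * s ^ (α - 1))) := by ring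
    _ ≤ 4 * (C * riNorm σ v) := mul_le_mul_right (hlow.trans hb) _
    _ ≤ _ := by gcongr

theorem pairing_anti {α : ℝ} (hα : α < 1) {τ τ' : ℝ} (hτ : 0 < τ) (h : τ ≤ τ') (f : ℝ → ℝ) :
    pairing α τ' f ≤ pairing α τ f := by
  refine lintegral_mono fun s => ?_
  gcongr
  exact min_le_min (Real.rpow_le_rpow_of_nonpos hτ h (by linarith)) le_rfl

theorem isLargestRI_optimalNorm {α β : ℝ} (hα0 : 0 < α) (hα : α < 1) (hβ : 0 < β)
    (hαβ : 1 ≤ α + 1 / β) {φ : ℝ → ℝ} (hφ : IsQuasiconcave φ) :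
    IsLargestRI α β φ (optimalNorm α fun τ => φ (τ ^ (1 / β))) := by
  have hψ := hφ.isWeight hβ
  have hρ := isRINorm_optimalNorm hα0 hα hψ
  refine ⟨hρ, hardyBounded_of_pairing (C := 1) hα hβ hαβ hφ fun f hf _ τ hτ => ?_, ?_⟩
  · rw [ENNReal.coe_one, one_mul, riNorm, optimalNorm]
    refine le_iSup₂_of_le τ hτ ?_
    gcongr
    refine (lintegral_abs_mul_kern_le hα hτ.1 hf).trans_eq ?_
    simp only [pairing, rearrangement_abs]
  · rintro σ hσ ⟨C, hC⟩ f hf hfin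
    obtain ⟨M, hM0, hM⟩ := hψ.bdd
    have hh : (1 / 2 : ℝ) ∈ Ioo (0 : ℝ) 1 := by constructor <;> norm_num
    have hψh := hψ.pos _ hh
    have hb : ∀ τ, 0 < τ → τ ≤ 1 / 2 →
        ENNReal.ofReal (φ (τ ^ (1 / β))) * pairing α τ f ≤ 4 * (C * riNorm σ f) :=
      fun τ h0 h1 => hσ.pairing_le hα0 hα hβ hC hf hfin h0 h1
    have hK : 4 * ((C : ℝ≥0∞) * riNorm σ f) < ∞ := by finiteness
    have hp : pairing α (1 / 2) f < ∞ := by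
      refine ENNReal.lt_top_of_mul_ne_top_right ((hb _ hh.1 le_rfl).trans_lt hK).ne ?_
      exact (ENNReal.ofReal_pos.2 hψh).ne'
    -- For `τ > 1/2` the translation is not available, but there `ψ` is bounded and the pairing is
    -- at most the one at `1/2`.
    refine lt_of_le_of_lt (b := max (4 * (C * riNorm σ f))
      (ENNReal.ofReal M * pairing α (1 / 2) f)) (iSup₂_le fun τ hτ => ?_)
      (max_lt hK (ENNReal.mul_lt_top ENNReal.ofReal_lt_top hp))
    have hpe : pairing α τ (fun x => |f x|) = pairing α τ f := by
      simp only [pairing, rearrangement_abs]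
    rw [hpe]
    rcases le_total τ (1 / 2) with h | h
    · exact (hb τ hτ.1 h).trans (le_max_left _ _)
    · refine le_trans ?_ (le_max_right _ _)
      gcongr
      · exact hM τ hτ
      · exact pairing_anti hα hh.1 h f

theorem IsLargestRI.exists_le_mul {α β : ℝ} {φ : ℝ → ℝ} {ρ σ : (ℝ → ℝ) → ℝ≥0∞}
    (hρ : IsLargestRI α β φ ρ) (hσ : IsLargestRI α β φ σ) :
    ∃ C : ℝ≥0, ∀ f, MemMPlus f → ρ f ≤ C * σ f :=
  hσ.isRINorm.exists_le_mul hρ.isRINorm fun f hf => hρ.largest σ hσ.isRINorm hσ.bounded f hf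

/-! ### Young functions -/

/-- `a` is the density of the Young function `A`. -/
structure IsYoungDensity (a A : ℝ → ℝ) : Prop where
  zero : a 0 = 0
  pos : ∀ s, 0 < s → 0 < a s
  mono : MonotoneOn a (Ici 0)
  tendsto : Tendsto a atTop atTop
  eq : ∀ t, 0 ≤ t → A t = ∫ s in (0 : ℝ)..t, a s

theorem IsYoung.exists_density {A : ℝ → ℝ} (hA : IsYoung A) : ∃ a, IsYoungDensity a A := by
  obtain ⟨a, h1, h2, -, h4, h5, h6⟩ := hA
  exact ⟨a, h1, h2, h4, h5, h6⟩

namespace IsYoungDensity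

variable {a A : ℝ → ℝ}

theorem density_nonneg (h : IsYoungDensity a A) {s : ℝ} (hs : 0 ≤ s) : 0 ≤ a s := by
  rcases hs.eq_or_lt with rfl | hs
  · exact h.zero.ge
  · exact (h.pos s hs).le

theorem intervalIntegrable (h : IsYoungDensity a A) {x y : ℝ} (hx : 0 ≤ x) (hy : 0 ≤ y) :
    IntervalIntegrable a volume x y :=
  (h.mono.mono fun _ hz => (le_min hx hy).trans hz.1).intervalIntegrable

theorem sub_eq (h : IsYoungDensity a A) {x y : ℝ} (hx : 0 ≤ x) (hy : 0 ≤ y) :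
    A y - A x = ∫ s in x..y, a s := by
  rw [h.eq y hy, h.eq x hx, intervalIntegral.integral_interval_sub_left
    (h.intervalIntegrable le_rfl hy) (h.intervalIntegrable le_rfl hx)]

theorem le_sub (h : IsYoungDensity a A) {x y m : ℝ} (hx : 0 ≤ x) (hxy : x ≤ y)
    (hm : ∀ r ∈ Ioo x y, m ≤ a r) : m * (y - x) ≤ A y - A x := by
  rw [h.sub_eq hx (hx.trans hxy)]
  have := intervalIntegral.integral_mono_on_of_le_Ioo hxy
    (intervalIntegrable_const (c := m) (μ := volume)) (h.intervalIntegrable hx (hx.trans hxy)) hm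
  simpa [mul_comm] using this

theorem sub_le (h : IsYoungDensity a A) {x y m : ℝ} (hx : 0 ≤ x) (hxy : x ≤ y)
    (hm : ∀ r ∈ Ioo x y, a r ≤ m) : A y - A x ≤ m * (y - x) := by
  rw [h.sub_eq hx (hx.trans hxy)]
  have := intervalIntegral.integral_mono_on_of_le_Ioo hxy
    (h.intervalIntegrable hx (hx.trans hxy)) (intervalIntegrable_const (c := m) (μ := volume)) hm
  simpa [mul_comm] using this

/-- Convexity of `A` in the form used below; it rests on monotonicity of the density alone. -/
theorem subgradient (h : IsYoungDensity a A) {x y : ℝ} (hx : 0 ≤ x) (hy : 0 ≤ y) :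
    a x * (y - x) ≤ A y - A x := by
  rcases le_total x y with hxy | hxy
  · exact h.le_sub hx hxy fun r hr => h.mono hx (hx.trans hr.1.le) hr.1.le
  · have := h.sub_le (m := a x) hy hxy fun r hr => h.mono (hy.trans hr.1.le) hx hr.2.le
    linarith

theorem apply_zero (h : IsYoungDensity a A) : A 0 = 0 := by simp [h.eq 0 le_rfl]

theorem monotoneOn (h : IsYoungDensity a A) : MonotoneOn A (Ici 0) := by
  intro x hx y hy hxy
  have := h.le_sub (m := 0) hx hxy fun r hr => h.density_nonneg (le_trans hx hr.1.le)
  linarith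

theorem nonneg (h : IsYoungDensity a A) {s : ℝ} (hs : 0 ≤ s) : 0 ≤ A s :=
  h.apply_zero.symm.le.trans (h.monotoneOn self_mem_Ici hs hs)

theorem mul_le (h : IsYoungDensity a A) {θ s : ℝ} (h0 : 0 ≤ θ) (h1 : θ ≤ 1) (hs : 0 ≤ s) :
    A (θ * s) ≤ θ * A s := by
  have hθ : 0 ≤ θ * s := by positivity
  have e1 := h.subgradient hθ hs
  have e2 := h.subgradient hθ le_rfl
  rw [h.apply_zero] at e2
  nlinarith [mul_le_mul_of_nonneg_left e1 h0,
    mul_le_mul_of_nonneg_left e2 (sub_nonneg.2 h1)]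

theorem le_mul_density (h : IsYoungDensity a A) {s : ℝ} (hs : 0 ≤ s) : A s ≤ s * a s := by
  have := h.subgradient hs le_rfl
  rw [h.apply_zero] at this
  linarith

theorem mul_density_le (h : IsYoungDensity a A) {s : ℝ} (hs : 0 ≤ s) : s * a s ≤ A (2 * s) := by
  have := h.subgradient hs (show 0 ≤ 2 * s by positivity)
  linarith [h.nonneg hs]

/-- `A` is arbitrary on the negative axis, so measurability is obtained from the monotone function
`A (max x 0)`. -/
theorem measurable_comp (h : IsYoungDensity a A) {μ : Measure ℝ} {f : ℝ → ℝ}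
    (hf : AEMeasurable f μ) (h0 : ∀ x, 0 ≤ f x) : AEMeasurable (fun x => A (f x)) μ := by
  have hm : Monotone fun x => A (max x 0) := fun x y hxy =>
    h.monotoneOn (mem_Ici.2 (le_max_right x 0)) (mem_Ici.2 (le_max_right y 0)) (max_le_max hxy le_rfl)
  have := hm.measurable.comp_aemeasurable hf
  refine this.congr (ae_of_all _ fun x => ?_)
  simp [max_eq_left (h0 x)]

end IsYoungDensity

/-! ### The complementary function and the equality case of Young's inequality -/

/-- The generalized inverse of `a`. -/
noncomputable def genInv (a : ℝ → ℝ) (y : ℝ) : ℝ := sSup {s | 0 ≤ s ∧ a s ≤ y}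

namespace IsYoungDensity

variable {a A : ℝ → ℝ}

theorem bddAbove (h : IsYoungDensity a A) (y : ℝ) : BddAbove {s | 0 ≤ s ∧ a s ≤ y} := by
  obtain ⟨R, hR⟩ := eventually_atTop.1 (h.tendsto.eventually_gt_atTop y)
  exact ⟨R, fun s hs => by
    by_contra hlt
    exact absurd hs.2 (not_le.2 (hR s (not_le.1 hlt).le))⟩

theorem zero_mem (h : IsYoungDensity a A) {y : ℝ} (hy : 0 ≤ y) :
    (0 : ℝ) ∈ {s | 0 ≤ s ∧ a s ≤ y} := ⟨le_rfl, h.zero.trans_le hy⟩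

theorem genInv_nonneg (y : ℝ) : 0 ≤ genInv a y := Real.sSup_nonneg fun _ hs => hs.1

theorem genInv_monotoneOn (h : IsYoungDensity a A) : MonotoneOn (genInv a) (Ici 0) :=
  fun _ hx y _ hxy => csSup_le_csSup (h.bddAbove y) ⟨0, h.zero_mem hx⟩
    fun _ hs => ⟨hs.1, hs.2.trans hxy⟩

/-- The density is at most `y` before `genInv a y` and exceeds `y` after it, so the concave function
`s ↦ s y - A s` peaks there. -/
theorem sub_le_genInv (h : IsYoungDensity a A) {s y : ℝ} (hs : 0 ≤ s) (hy : 0 ≤ y) :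
    s * y - A s ≤ genInv a y * y - A (genInv a y) := by
  have h0 : 0 ≤ genInv a y := genInv_nonneg y
  rcases le_total (genInv a y) s with hle | hle
  · have := h.le_sub (m := y) h0 hle fun r hr => by
      by_contra hlt
      exact absurd (le_csSup (h.bddAbove y) ⟨h0.trans hr.1.le, (not_le.1 hlt).le⟩) (not_le.2 hr.1)
    linarith
  · have := h.sub_le (m := y) hs hle fun r hr => by
      obtain ⟨r', hr', hlt⟩ := exists_lt_of_lt_csSup ⟨0, h.zero_mem hy⟩ hr.2
      exact (h.mono (hs.trans hr.1.le) hr'.1 hlt.le).trans hr'.2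
    linarith

theorem bddAbove_complementary (h : IsYoungDensity a A) {y : ℝ} (hy : 0 ≤ y) :
    BddAbove ((fun s => s * y - A s) '' Ioi 0) :=
  ⟨_, by rintro _ ⟨s, hs, rfl⟩; exact h.sub_le_genInv (le_of_lt hs) hy⟩

/-- The supremum omits `s = 0`, so the value `0` is approached by small `s`, where `A s ≤ s * a 1`.
-/
theorem complementary_nonneg (h : IsYoungDensity a A) {y : ℝ} (hy : 0 ≤ y) :
    0 ≤ complementary A y := by
  refine le_of_forall_pos_le_add fun ε hε => ?_
  have ha := h.pos 1 one_pos
  set s := min 1 (ε / a 1)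
  have hs : 0 < s := by positivity
  have h1 : s * y - A s ≤ complementary A y :=
    le_csSup (h.bddAbove_complementary hy) ⟨s, hs, rfl⟩
  have h2 := h.le_mul_density hs.le
  have h3 : a s ≤ a 1 := h.mono hs.le (mem_Ici.2 zero_le_one) (min_le_left _ _)
  have h4 : s * a 1 ≤ ε := (le_div_iff₀ ha).1 (min_le_right _ _)
  nlinarith [mul_nonneg hs.le hy]

/-- Young's inequality. -/
theorem young (h : IsYoungDensity a A) {s y : ℝ} (hs : 0 ≤ s) (hy : 0 ≤ y) :
    s * y ≤ A s + complementary A y := by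
  rcases hs.eq_or_lt with rfl | hs
  · simpa [h.apply_zero] using h.complementary_nonneg hy
  · have : s * y - A s ≤ complementary A y :=
      le_csSup (h.bddAbove_complementary hy) ⟨s, hs, rfl⟩
    linarith

theorem complementary_le (hy : ∀ s, 0 < s → s * y - A s ≤ m) : complementary A y ≤ m :=
  csSup_le (nonempty_Ioi.image _) (by rintro _ ⟨s, hs, rfl⟩; exact hy s hs)

/-- The equality case of Young's inequality. -/
theorem young_eq (h : IsYoungDensity a A) {y : ℝ} (hy : 0 ≤ y) :
    genInv a y * y = A (genInv a y) + complementary A y := by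
  refine le_antisymm (h.young (genInv_nonneg y) hy) ?_
  have := complementary_le fun s hs => h.sub_le_genInv (le_of_lt hs) hy
  linarith

theorem complementary_subgradient (h : IsYoungDensity a A) {x y : ℝ} (hx : 0 ≤ x) (hy : 0 ≤ y) :
    genInv a x * (y - x) ≤ complementary A y - complementary A x := by
  have h1 := h.young_eq hx
  have h2 := h.young (genInv_nonneg (a := a) x) hy
  linarith

theorem complementary_monotoneOn (h : IsYoungDensity a A) :
    MonotoneOn (complementary A) (Ici 0) := fun x hx y hy hxy => by
  have := h.complementary_subgradient hx hy
  nlinarith [mul_nonneg (genInv_nonneg (a := a) x) (sub_nonneg.2 hxy)]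

theorem complementary_continuousOn (h : IsYoungDensity a A) (R : ℝ) :
    ContinuousOn (complementary A) (Icc 0 R) := by
  have hg : 0 ≤ genInv a R := genInv_nonneg R
  have key : ∀ x ∈ Icc 0 R, ∀ y ∈ Icc 0 R,
      complementary A x - complementary A y ≤ genInv a R * |x - y| := by
    intro x hx y hy
    have h1 := h.complementary_subgradient hx.1 hy.1
    have h2 : genInv a x ≤ genInv a R := h.genInv_monotoneOn hx.1 (hx.1.trans hx.2) hx.2
    have h3 := genInv_nonneg (a := a) x
    nlinarith [le_abs_self (x - y), abs_nonneg (x - y)]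
  refine LipschitzOnWith.continuousOn (K := (genInv a R).toNNReal)
    (LipschitzOnWith.of_dist_le_mul fun x hx y hy => ?_)
  rw [Real.dist_eq, Real.dist_eq, Real.coe_toNNReal _ hg, abs_le]
  constructor
  · have := key y hy x hx
    rw [abs_sub_comm] at this
    linarith
  · exact key x hx y hy

end IsYoungDensity

/-! ### Boundedness of the Hardy operator on Orlicz spaces -/

/-- Apply Young's inequality to the product of `|f| / l` and `c ψ(τ) k_τ`, with `l` admissible in
the Luxemburg norm; the two integrals contribute `1` and `K`, giving the constant `(1 + K) / c`. -/
theorem IsYoungDensity.hardyBounded {a A : ℝ → ℝ} (h : IsYoungDensity a A) {α β : ℝ}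
    (hα : α < 1) (hβ : 0 < β) (hαβ : 1 ≤ α + 1 / β) {φ : ℝ → ℝ} (hφ : IsQuasiconcave φ)
    {c K : ℝ} (hc : 0 < c) (hK : 0 ≤ K)
    (hI : ∀ τ ∈ Ioo (0 : ℝ) 1, ∫⁻ s, ENNReal.ofReal
      (complementary A (c * φ (τ ^ (1 / β)) * kern α τ s)) ∂muI ≤ ENNReal.ofReal K) :
    HardyBounded α β (luxemburgNorm A) (marcinkiewiczNorm φ) := by
  have hψ := hφ.isWeight hβ
  set C : ℝ≥0 := ((1 + K) / c).toNNReal with hCdef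
  have hC0 : (C : ℝ≥0∞) ≠ 0 := (ENNReal.ofReal_pos.2 (by positivity)).ne'
  refine hardyBounded_of_pairing (C := C) hα hβ hαβ hφ fun f hf _ τ hτ => ?_
  rw [mul_comm (C : ℝ≥0∞), ← ENNReal.div_le_iff hC0 ENNReal.coe_ne_top]
  refine le_iInf₂ fun l hl => ?_
  obtain ⟨hl0, hl1⟩ := hl
  rw [ENNReal.div_le_iff hC0 ENNReal.coe_ne_top]
  have hψτ : 0 < φ (τ ^ (1 / β)) := hψ.pos τ hτ
  set w := φ (τ ^ (1 / β))
  have hfl : AEMeasurable (fun x => |f x| / l) muI := hf.abs.div_const l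
  calc ENNReal.ofReal w * ∫⁻ s, ENNReal.ofReal |f s| * ENNReal.ofReal (kern α τ s) ∂muI
      = ∫⁻ s, ENNReal.ofReal w * (ENNReal.ofReal |f s| * ENNReal.ofReal (kern α τ s)) ∂muI :=
        (lintegral_const_mul' _ _ ENNReal.ofReal_ne_top).symm
    _ ≤ ∫⁻ s, ENNReal.ofReal (l / c) * (ENNReal.ofReal (A (|f s| / l))
          + ENNReal.ofReal (complementary A (c * w * kern α τ s))) ∂muI := by
        refine lintegral_mono_ae ?_
        filter_upwards [ae_mem_Ioo] with s hs
        have hk := kern_nonneg α hτ.1 hs.1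
        have hy : 0 ≤ c * w * kern α τ s := by positivity
        have hfs : 0 ≤ |f s| / l := by positivity
        rw [← ENNReal.ofReal_mul (abs_nonneg _), ← ENNReal.ofReal_mul hψτ.le,
          ← ENNReal.ofReal_add (h.nonneg hfs) (h.complementary_nonneg hy),
          ← ENNReal.ofReal_mul (by positivity)]
        refine ENNReal.ofReal_le_ofReal ?_
        calc w * (|f s| * kern α τ s) = l / c * (|f s| / l * (c * w * kern α τ s)) := by
              field_simp
          _ ≤ _ := by gcongr; exact h.young hfs hy
    _ = ENNReal.ofReal (l / c) * (∫⁻ s, ENNReal.ofReal (A (|f s| / l)) ∂muI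
          + ∫⁻ s, ENNReal.ofReal (complementary A (c * w * kern α τ s)) ∂muI) := by
        rw [lintegral_const_mul' _ _ ENNReal.ofReal_ne_top, lintegral_add_left'
          (h.measurable_comp hfl fun x => by positivity).ennreal_ofReal]
    _ ≤ ENNReal.ofReal (l / c) * (1 + ENNReal.ofReal K) := by
        gcongr
        exact hI τ hτ
    _ = ENNReal.ofReal l * C := by
        rw [← ENNReal.ofReal_one, ← ENNReal.ofReal_add zero_le_one hK, hCdef, ← ENNReal.ofReal,
          ← ENNReal.ofReal_mul (by positivity), ← ENNReal.ofReal_mul hl0.le]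
        congr 1
        ring

/-- Test on the extremal function `f = genInv a (y s)` on `(τ,1)`, with `y s = c ψ(τ) s ^ (α - 1)`.
If `N` is the modular of `f`, equality in Young's inequality gives `N + ∫ Ã(y) = c ψ(τ) ∫ f s ^ (α -
1) ≤ c C ‖f‖ ≤ max 1 N`, where `Ã` is `complementary A` and the integrals run over `(τ,1)`. As `N`
is finite, it can be cancelled. -/
theorem IsYoungDensity.lintegral_complementary_le {a A : ℝ → ℝ} (h : IsYoungDensity a A) {α β : ℝ}
    (hα : α < 1) (hβ : 0 < β) {φ : ℝ → ℝ} (hφ : IsQuasiconcave φ)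
    (hH : HardyBounded α β (luxemburgNorm A) (marcinkiewiczNorm φ)) :
    ∃ c, 0 < c ∧ ∀ τ ∈ Ioo (0 : ℝ) 1, ∫⁻ s in Ioo τ 1, ENNReal.ofReal
      (complementary A (c * φ (τ ^ (1 / β)) * s ^ (α - 1))) ≤ 1 := by
  obtain ⟨C, hC⟩ := hH
  have hψ := hφ.isWeight hβ
  refine ⟨1 / (C + 1), by positivity, fun τ hτ => ?_⟩
  have hψτ : 0 < φ (τ ^ (1 / β)) := hψ.pos τ hτ
  set w := φ (τ ^ (1 / β)) with hw
  set c : ℝ := 1 / (C + 1) with hcdef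
  have hc : 0 < c := by positivity
  have hcC : c * C ≤ 1 := by
    rw [hcdef, one_div_mul_eq_div, div_le_one (by positivity)]
    linarith
  set y : ℝ → ℝ := fun s => c * w * s ^ (α - 1) with hydef
  have hy0 : ∀ s, 0 < s → 0 ≤ y s := fun s hs => by
    have := Real.rpow_pos_of_pos hs (α - 1)
    positivity
  have hyanti : AntitoneOn y (Ioi 0) := fun s hs t ht hst =>
    mul_le_mul_of_nonneg_left (Real.rpow_le_rpow_of_nonpos hs hst (by linarith)) (by positivity)
  set f : ℝ → ℝ := (Ioo τ 1).indicator fun s => genInv a (y s) with hfdef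
  have hf0 : ∀ s, 0 ≤ f s := fun s => indicator_nonneg (fun _ _ => IsYoungDensity.genInv_nonneg _) _
  have hfe : ∀ s ∈ Ioo τ 1, f s = genInv a (y s) := fun s hs => indicator_of_mem hs _
  have hsub : Ioo τ 1 ⊆ Ioo 0 1 := Ioo_subset_Ioo_left hτ.1.le
  have hres : muI.restrict (Ioo τ 1) = volume.restrict (Ioo τ 1) := by
    rw [muI, Measure.restrict_restrict measurableSet_Ioo, inter_eq_left.2 hsub]
  have hf : MemM f := by
    rw [MemM, hfdef, aemeasurable_indicator_iff measurableSet_Ioo, hres]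
    exact aemeasurable_restrict_of_antitoneOn measurableSet_Ioo fun s hs t ht hst =>
      h.genInv_monotoneOn (hy0 t (hsub ht).1) (hy0 s (hsub hs).1)
        (hyanti (hsub hs).1 (hsub ht).1 hst)
  set N : ℝ≥0∞ := ∫⁻ s, ENNReal.ofReal (A (f s)) ∂muI with hNdef
  have hNt : N ≠ ∞ := by
    refine ne_top_of_le_ne_top (b := ENNReal.ofReal (A (genInv a (y τ)))) ENNReal.ofReal_ne_top ?_
    refine (lintegral_mono (g := fun _ => ENNReal.ofReal (A (genInv a (y τ)))) fun s => ?_).trans ?_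
    · refine ENNReal.ofReal_le_ofReal (h.monotoneOn (hf0 s) (IsYoungDensity.genInv_nonneg _) ?_)
      by_cases hs : s ∈ Ioo τ 1
      · rw [hfe s hs]
        exact h.genInv_monotoneOn (hy0 s (hsub hs).1) (hy0 τ hτ.1)
          (hyanti hτ.1 (hsub hs).1 hs.1.le)
      · rw [hfdef, indicator_of_notMem hs]
        exact IsYoungDensity.genInv_nonneg _
    · simp
  -- Convexity gives `A (f / l) ≤ A f / l` for `l ≥ 1`, so the Luxemburg norm is at most `max 1 N`.
  set l : ℝ := max 1 N.toReal with hldef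
  have hl1 : 1 ≤ l := le_max_left _ _
  have hlN : ENNReal.ofReal l = max 1 N := by
    rw [hldef, ENNReal.ofReal_max, ENNReal.ofReal_toReal hNt, ENNReal.ofReal_one]
  have hlux : luxemburgNorm A f ≤ ENNReal.ofReal l := by
    refine iInf₂_le l ⟨by linarith, ?_⟩
    calc ∫⁻ x, ENNReal.ofReal (A (|f x| / l)) ∂muI
        ≤ ∫⁻ x, ENNReal.ofReal l⁻¹ * ENNReal.ofReal (A (f x)) ∂muI := by
          refine lintegral_mono fun x => ?_
          rw [← ENNReal.ofReal_mul (by positivity), abs_of_nonneg (hf0 x), div_eq_inv_mul]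
          exact ENNReal.ofReal_le_ofReal
            (h.mul_le (by positivity) (inv_le_one_of_one_le₀ hl1) (hf0 x))
      _ = ENNReal.ofReal l⁻¹ * N := lintegral_const_mul' _ _ ENNReal.ofReal_ne_top
      _ ≤ ENNReal.ofReal l⁻¹ * ENNReal.ofReal l := by
          gcongr
          rw [hlN]
          exact le_max_right _ _
      _ = 1 := by
          rw [← ENNReal.ofReal_mul (by positivity), inv_mul_cancel₀ (by positivity)]
          simp
  obtain ⟨hi, hb⟩ := hC f hf (hlux.trans_lt ENNReal.ofReal_lt_top)
  have hlow := ofReal_mul_hardyOp_le hβ (φ := φ) (ae_of_all _ hf0) hi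
    (rpow_mem_Ioo hτ (one_div_pos.2 hβ))
  rw [rpow_rpow_cancel' hτ.1.le hβ.ne', ← hw] at hlow
  have hsum : N + ∫⁻ s in Ioo τ 1, ENNReal.ofReal (complementary A (y s)) ≤ ENNReal.ofReal l := by
    have hNr : N = ∫⁻ s in Ioo τ 1, ENNReal.ofReal (A (f s)) := by
      rw [← hres, ← lintegral_indicator measurableSet_Ioo, hNdef]
      refine lintegral_congr fun s => ?_
      by_cases hs : s ∈ Ioo τ 1
      · rw [indicator_of_mem hs]
      · rw [indicator_of_notMem hs, hfdef, indicator_of_notMem hs, h.apply_zero,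
          ENNReal.ofReal_zero]
    have hAf : AEMeasurable (fun s => ENNReal.ofReal (A (f s))) (volume.restrict (Ioo τ 1)) := by
      rw [← hres]
      exact (h.measurable_comp hf hf0).ennreal_ofReal.restrict
    rw [hNr, ← lintegral_add_left' hAf]
    calc ∫⁻ s in Ioo τ 1, (ENNReal.ofReal (A (f s)) + ENNReal.ofReal (complementary A (y s)))
        = ∫⁻ s in Ioo τ 1, ENNReal.ofReal (c * w) * ENNReal.ofReal (f s * s ^ (α - 1)) := by
          refine setLIntegral_congr_fun measurableSet_Ioo fun s hs => ?_
          have hys := hy0 s (hsub hs).1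
          rw [← ENNReal.ofReal_add (h.nonneg (hf0 s)) (h.complementary_nonneg hys),
            ← ENNReal.ofReal_mul (by positivity), hfe s hs, ← h.young_eq hys, hydef]
          congr 1
          ring
      _ = ENNReal.ofReal c * (ENNReal.ofReal w *
            ∫⁻ s in Ioo τ 1, ENNReal.ofReal (f s * s ^ (α - 1))) := by
          rw [lintegral_const_mul' _ _ ENNReal.ofReal_ne_top, ENNReal.ofReal_mul hc.le, mul_assoc]
      _ ≤ ENNReal.ofReal c * (C * ENNReal.ofReal l) := by
          gcongr ENNReal.ofReal c * ?_
          exact hlow.trans (hb.trans (by gcongr))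
      _ ≤ ENNReal.ofReal l := by
          rw [← mul_assoc, ← ENNReal.ofReal_coe_nnreal, ← ENNReal.ofReal_mul hc.le,
            ← ENNReal.ofReal_mul (by positivity)]
          exact ENNReal.ofReal_le_ofReal (mul_le_of_le_one_left (by positivity) hcC)
  rw [hlN] at hsum
  rcases le_total N 1 with hN | hN
  · rw [max_eq_left hN] at hsum
    exact le_add_self.trans hsum
  · rw [max_eq_right hN] at hsum
    have : ∫⁻ s in Ioo τ 1, ENNReal.ofReal (complementary A (y s)) ≤ 0 := by
      refine ENNReal.le_of_add_le_add_left hNt ?_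
      rwa [add_zero]
    exact this.trans zero_le

/-! ### The fundamental function of the optimal space -/

/-- The supremum of `ψ τ * τ ^ (α - 1)` over `t ≤ τ < 1`. -/
noncomputable def tail (α : ℝ) (ψ : ℝ → ℝ) (t : ℝ) : ℝ :=
  sSup ((fun τ => ψ τ * τ ^ (α - 1)) '' Ico t 1)

namespace IsWeight

variable {α : ℝ} {ψ : ℝ → ℝ}

theorem bddAbove_tail (hψ : IsWeight ψ) (hα : α < 1) {t : ℝ} (ht : 0 < t) :
    BddAbove ((fun τ => ψ τ * τ ^ (α - 1)) '' Ico t 1) := by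
  obtain ⟨M, hM0, hM⟩ := hψ.bdd
  refine ⟨M * t ^ (α - 1), ?_⟩
  rintro _ ⟨τ, hτ, rfl⟩
  have hτ1 : τ ∈ Ioo (0 : ℝ) 1 := ⟨ht.trans_le hτ.1, hτ.2⟩
  exact mul_le_mul (hM τ hτ1) (Real.rpow_le_rpow_of_nonpos ht hτ.1 (by linarith))
    (Real.rpow_nonneg hτ1.1.le _) hM0.le

theorem le_tail (hψ : IsWeight ψ) (hα : α < 1) {t τ : ℝ} (ht : 0 < t) (h : t ≤ τ) (hτ : τ < 1) :
    ψ τ * τ ^ (α - 1) ≤ tail α ψ t :=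
  le_csSup (hψ.bddAbove_tail hα ht) ⟨τ, ⟨h, hτ⟩, rfl⟩

theorem tail_le {t m : ℝ} (ht : t < 1) (h : ∀ τ, t ≤ τ → τ < 1 → ψ τ * τ ^ (α - 1) ≤ m) :
    tail α ψ t ≤ m :=
  csSup_le ((nonempty_Ico.2 ht).image _) (by rintro _ ⟨τ, hτ, rfl⟩; exact h τ hτ.1 hτ.2)

theorem tail_pos (hψ : IsWeight ψ) (hα : α < 1) {t : ℝ} (ht : t ∈ Ioo (0 : ℝ) 1) :
    0 < tail α ψ t :=
  (mul_pos (hψ.pos t ht) (Real.rpow_pos_of_pos ht.1 _)).trans_le (hψ.le_tail hα ht.1 le_rfl ht.2)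

theorem half_le_tail (hψ : IsWeight ψ) (hα : α < 1) {t : ℝ} (ht : t ∈ Ioo (0 : ℝ) 1) :
    ψ (1 / 2) ≤ tail α ψ t := by
  have hh : (1 / 2 : ℝ) ∈ Ioo (0 : ℝ) 1 := by constructor <;> norm_num
  have hm : max t (1 / 2) ∈ Ioo (0 : ℝ) 1 := ⟨ht.1.trans_le (le_max_left _ _), max_lt ht.2 hh.2⟩
  refine le_trans ?_ (hψ.le_tail hα ht.1 (le_max_left t (1 / 2)) hm.2)
  refine (hψ.mono hh hm (le_max_right _ _)).trans (le_mul_of_one_le_right (hψ.pos _ hm).le ?_)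
  exact Real.one_le_rpow_of_pos_of_le_one_of_nonpos hm.1 hm.2.le (by linarith)

theorem tail_antitoneOn (hψ : IsWeight ψ) (hα : α < 1) : AntitoneOn (tail α ψ) (Ioo 0 1) :=
  fun _ hs _ ht hst => tail_le ht.2 fun _ h1 h2 => hψ.le_tail hα hs.1 (hst.trans h1) h2

/-- For `s ≤ τ ≤ t`, `s ψ(τ) τ ^ (α - 1) ≤ ψ(t) τ ^ α ≤ ψ(t) t ^ α`, which is `t` times a competitor
for `tail α ψ t`; for `τ ≥ t` the competitors agree and `s ≤ t`. -/
theorem mul_tail_monotoneOn (hψ : IsWeight ψ) (hα0 : 0 < α) (hα : α < 1) :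
    MonotoneOn (fun t => t * tail α ψ t) (Ioo 0 1) := by
  intro s hs t ht hst
  have key : tail α ψ s ≤ t * tail α ψ t / s := by
    refine tail_le hs.2 fun τ h1 h2 => ?_
    have hτ : τ ∈ Ioo (0 : ℝ) 1 := ⟨hs.1.trans_le h1, h2⟩
    rw [le_div_iff₀ hs.1]
    rcases le_total t τ with h | h
    · have := hψ.le_tail hα ht.1 h h2
      have h0 := hψ.tail_pos hα ht
      nlinarith [hs.1]
    · calc ψ τ * τ ^ (α - 1) * s ≤ ψ t * τ ^ (α - 1) * τ := by
            have := hψ.mono hτ ht h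
            have := Real.rpow_pos_of_pos hτ.1 (α - 1)
            have := hψ.pos t ht
            have := hs.1
            gcongr
        _ = ψ t * τ ^ α := by
            rw [mul_assoc, ← Real.rpow_add_one hτ.1.ne']
            simp
        _ ≤ ψ t * t ^ α := by
            have := hψ.pos t ht
            gcongr
            exact hτ.1.le
        _ = t * (ψ t * t ^ (α - 1)) := by
            rw [mul_left_comm, mul_comm t, ← Real.rpow_add_one ht.1.ne']
            simp
        _ ≤ t * tail α ψ t := by
            gcongr
            · exact ht.1.le
            · exact hψ.le_tail hα ht.1 le_rfl ht.2
  rw [le_div_iff₀ hs.1] at key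
  simpa [mul_comm] using key

theorem mul_tail_le (hα : α < 1) {M : ℝ} (hM0 : 0 < M)
    (hM : ∀ t ∈ Ioo (0 : ℝ) 1, ψ t ≤ M) {t : ℝ} (ht : t ∈ Ioo (0 : ℝ) 1) :
    t * tail α ψ t ≤ M * t ^ α := by
  have : tail α ψ t ≤ M * t ^ (α - 1) := tail_le ht.2 fun τ h1 h2 =>
    mul_le_mul (hM τ ⟨ht.1.trans_le h1, h2⟩)
      (Real.rpow_le_rpow_of_nonpos ht.1 h1 (by linarith))
      (Real.rpow_nonneg (ht.1.le.trans h1) _) hM0.le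
  calc t * tail α ψ t ≤ t * (M * t ^ (α - 1)) := by gcongr; exact ht.1.le
    _ = M * t ^ α := by
      rw [mul_left_comm, mul_comm t, ← Real.rpow_add_one ht.1.ne']
      simp

end IsWeight

theorem distribution_chi {t : ℝ} (ht : t ≤ 1) {l : ℝ} (hl0 : 0 ≤ l) (hl1 : l < 1) :
    distribution (chi t) l = ENNReal.ofReal t := by
  rw [← muI_Ioo ht, distribution]
  congr 1
  ext x
  by_cases hx : x ∈ Ioo 0 t
  · simp [chi, hl1, hx.1, hx.2]
  · have : ¬ (l < |chi t x|) := by simp [chi, indicator_of_notMem hx, hl0]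
    exact iff_of_false this hx

theorem memMPlus_chi (t : ℝ) : MemMPlus (chi t) :=
  ⟨(measurable_const.indicator measurableSet_Ioo).aemeasurable,
    ae_of_all _ fun _ => indicator_nonneg (fun _ _ => zero_le_one) _⟩

theorem chi_abs (t : ℝ) : (fun x => |chi t x|) = chi t :=
  funext fun _ => abs_of_nonneg (indicator_nonneg (fun _ _ => zero_le_one) _)

theorem rearrangement_chi {t : ℝ} (ht : t ∈ Ioo (0 : ℝ) 1) {s : ℝ} (hs : 0 < s) :
    rearrangement (chi t) s = chi t s := by
  have hm := (memMPlus_chi t).1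
  have h0 := rearrangement_nonneg (chi t) s
  by_cases hst : s < t
  · rw [show chi t s = 1 from indicator_of_mem (show s ∈ Ioo 0 t from ⟨hs, hst⟩) _]
    refine le_antisymm (rearrangement_le zero_le_one ?_) ?_
    · have : distribution (chi t) 1 = 0 := by
        rw [distribution]
        convert measure_empty (μ := muI)
        ext x
        by_cases hx : x ∈ Ioo 0 t
        · simp [chi, indicator_of_mem hx]
        · simp [chi, indicator_of_notMem hx]
      rw [this]
      exact zero_le
    · by_contra hlt
      rw [not_le] at hlt
      have := (rearrangement_le_iff hm hs h0).1 le_rfl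
      rw [distribution_chi ht.2.le h0 hlt, ENNReal.ofReal_le_ofReal_iff hs.le] at this
      linarith
  · rw [show chi t s = 0 from indicator_of_notMem (fun h => hst h.2) _]
    refine le_antisymm (rearrangement_le le_rfl ?_) h0
    rw [distribution_chi ht.2.le le_rfl zero_lt_one]
    exact ENNReal.ofReal_le_ofReal (not_lt.1 hst)

theorem pairing_chi {α τ : ℝ} {t : ℝ} (ht : t ∈ Ioo (0 : ℝ) 1) :
    pairing α τ (chi t) = ∫⁻ s in Ioo 0 t, ENNReal.ofReal (kern α τ s) := by
  rw [← setLIntegral_muI _ ht.2.le, ← lintegral_indicator measurableSet_Ioo, pairing]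
  refine lintegral_congr_ae ?_
  filter_upwards [ae_mem_Ioo] with s hs
  rw [rearrangement_chi ht hs.1]
  by_cases h : s ∈ Ioo 0 t
  · rw [indicator_of_mem h, chi, indicator_of_mem h]
    simp
  · rw [indicator_of_notMem h, chi, indicator_of_notMem h]
    simp

/-- For `τ ≥ t` the kernel is at most `τ ^ (α - 1)`, giving a competitor of `tail` times `t`. For `τ
≤ t` use `ψ(τ) ≤ ψ(t)` and integrate `s ^ (α - 1)`, at the cost of `1 / α`. -/
theorem IsWeight.optimalNorm_chi_le {α : ℝ} {ψ : ℝ → ℝ} (hψ : IsWeight ψ) (hα0 : 0 < α)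
    (hα : α < 1) {t : ℝ} (ht : t ∈ Ioo (0 : ℝ) 1) :
    optimalNorm α ψ (chi t) ≤ ENNReal.ofReal (1 / α * (t * tail α ψ t)) := by
  have htp := hψ.tail_pos hα ht
  refine iSup₂_le fun τ hτ => ?_
  have hψτ := hψ.pos τ hτ
  rw [pairing_chi ht]
  rcases le_total t τ with h | h
  · calc _ ≤ ENNReal.ofReal (ψ τ) * ∫⁻ s in Ioo 0 t, ENNReal.ofReal (τ ^ (α - 1)) := by
          gcongr
          exact min_le_left _ _
      _ = ENNReal.ofReal (ψ τ * τ ^ (α - 1) * t) := by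
          have := Real.rpow_pos_of_pos hτ.1 (α - 1)
          rw [setLIntegral_const, Real.volume_Ioo, sub_zero, ← ENNReal.ofReal_mul (by positivity),
            ← ENNReal.ofReal_mul hψτ.le, mul_assoc]
      _ ≤ _ := by
          refine ENNReal.ofReal_le_ofReal ?_
          have h1 := hψ.le_tail hα ht.1 h hτ.2
          have h2 : 1 ≤ 1 / α := by rw [le_div_iff₀ hα0]; linarith
          have h3 : 0 < t * tail α ψ t := mul_pos ht.1 htp
          nlinarith [ht.1]
  · calc _ ≤ ENNReal.ofReal (ψ t) * ∫⁻ s in Ioo 0 t, ENNReal.ofReal (s ^ (α - 1)) := by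
          gcongr
          · exact hψ.mono hτ ht h
          · exact min_le_right _ _
      _ = ENNReal.ofReal (1 / α * (t * (ψ t * t ^ (α - 1)))) := by
          rw [lintegral_rpow_Ioo hα0 ht.1.le, ← ENNReal.ofReal_mul (hψ.pos t ht).le]
          congr 1
          have : t ^ α = t ^ (α - 1) * t := by
            rw [← Real.rpow_add_one ht.1.ne']
            simp
          rw [this]
          ring
      _ ≤ _ := by
          have := ht.1
          gcongr
          exact hψ.le_tail hα ht.1 le_rfl ht.2

theorem IsWeight.le_optimalNorm_chi {α : ℝ} {ψ : ℝ → ℝ} (hψ : IsWeight ψ) (hα0 : 0 < α)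
    (hα : α < 1) {t : ℝ} (ht : t ∈ Ioo (0 : ℝ) 1) :
    ENNReal.ofReal (t * tail α ψ t) ≤ optimalNorm α ψ (chi t) := by
  have hfin : optimalNorm α ψ (chi t) ≠ ∞ :=
    ne_top_of_le_ne_top ENNReal.ofReal_ne_top (hψ.optimalNorm_chi_le hα0 hα ht)
  rw [ENNReal.ofReal_le_iff_le_toReal hfin, ← le_div_iff₀' ht.1]
  refine tail_le ht.2 fun τ h1 h2 => ?_
  have hτ : τ ∈ Ioo (0 : ℝ) 1 := ⟨ht.1.trans_le h1, h2⟩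
  have hp := Real.rpow_pos_of_pos hτ.1 (α - 1)
  have hψτ := hψ.pos τ hτ
  rw [le_div_iff₀ ht.1, ← ENNReal.ofReal_le_iff_le_toReal hfin]
  refine le_iSup₂_of_le τ hτ ?_
  rw [pairing_chi ht, setLIntegral_congr_fun (g := fun _ => ENNReal.ofReal (τ ^ (α - 1)))
    measurableSet_Ioo fun s hs => by rw [kern_of_ge hα hs.1 (hs.2.le.trans h1)],
    setLIntegral_const, Real.volume_Ioo, sub_zero, ← ENNReal.ofReal_mul hp.le,
    ← ENNReal.ofReal_mul hψτ.le, mul_assoc]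

/-! ### The fundamental function of an Orlicz space -/

theorem IsYoungDensity.lintegral_chi {b B : ℝ → ℝ} (h : IsYoungDensity b B) {t : ℝ}
    (ht : t ∈ Ioo (0 : ℝ) 1) {l : ℝ} :
    ∫⁻ x, ENNReal.ofReal (B (|chi t x| / l)) ∂muI = ENNReal.ofReal (t * B (1 / l)) := by
  rw [ENNReal.ofReal_mul ht.1.le, ← muI_Ioo ht.2.le, mul_comm, ← setLIntegral_const,
    ← lintegral_indicator measurableSet_Ioo]
  refine lintegral_congr fun x => ?_
  by_cases hx : x ∈ Ioo 0 t
  · rw [indicator_of_mem hx, chi, indicator_of_mem hx, abs_one]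
  · rw [indicator_of_notMem hx, chi, indicator_of_notMem hx]
    simp [h.apply_zero]

theorem IsYoungDensity.mul_le_one_of_luxemburgNorm_lt {b B : ℝ → ℝ} (h : IsYoungDensity b B)
    {t : ℝ} (ht : t ∈ Ioo (0 : ℝ) 1) {m : ℝ}
    (hlt : luxemburgNorm B (chi t) < ENNReal.ofReal m) : t * B (1 / m) ≤ 1 := by
  obtain ⟨l, hl⟩ := iInf_lt_iff.1 hlt
  obtain ⟨⟨hl0, hl1⟩, hlm⟩ := iInf_lt_iff.1 hl
  rw [h.lintegral_chi ht, ENNReal.ofReal_le_one] at hl1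
  have hm : l < m := (ENNReal.ofReal_lt_ofReal_iff_of_nonneg hl0.le).1 hlm
  refine le_trans ?_ hl1
  gcongr
  · exact ht.1.le
  · have hm0 := hl0.trans hm
    exact h.monotoneOn (mem_Ici.2 (by positivity)) (mem_Ici.2 (by positivity)) (by gcongr)

theorem IsYoungDensity.luxemburgNorm_chi_le {b B : ℝ → ℝ} (h : IsYoungDensity b B)
    {t : ℝ} (ht : t ∈ Ioo (0 : ℝ) 1) {m : ℝ} (hm : 0 < m) (hle : t * B (1 / m) ≤ 1) :
    luxemburgNorm B (chi t) ≤ ENNReal.ofReal m :=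
  iInf₂_le m ⟨hm, by rwa [h.lintegral_chi ht, ENNReal.ofReal_le_one]⟩

/-- Two-sided estimate of a Young function whose Orlicz space has the fundamental function
`t * tail α ψ t`. -/
def YoungEstimate (α : ℝ) (ψ B : ℝ → ℝ) (D : ℝ) : Prop :=
  ∀ t ∈ Ioo (0 : ℝ) 1, t * B (1 / (D * (t * tail α ψ t))) ≤ 1 ∧ 1 < t * B (D / (t * tail α ψ t))

theorem FundamentalEquiv.trans {N₁ N₂ N₃ : (ℝ → ℝ) → ℝ≥0∞} (h : FundamentalEquiv N₁ N₂)
    (h' : FundamentalEquiv N₂ N₃) : FundamentalEquiv N₁ N₃ := by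
  obtain ⟨C, hC⟩ := h
  obtain ⟨C', hC'⟩ := h'
  refine ⟨C * C', fun t ht => ?_⟩
  push_cast
  constructor
  · calc N₁ (chi t) ≤ C * N₂ (chi t) := (hC t ht).1
      _ ≤ C * (C' * N₃ (chi t)) := by gcongr; exact (hC' t ht).1
      _ = _ := (mul_assoc _ _ _).symm
  · calc N₃ (chi t) ≤ C' * N₂ (chi t) := (hC' t ht).2
      _ ≤ C' * (C * N₁ (chi t)) := by gcongr; exact (hC t ht).2
      _ = _ := by ring

theorem FundamentalEquiv.symm {N₁ N₂ : (ℝ → ℝ) → ℝ≥0∞} (h : FundamentalEquiv N₁ N₂) :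
    FundamentalEquiv N₂ N₁ := by
  obtain ⟨C, hC⟩ := h
  exact ⟨C, fun t ht => (hC t ht).symm⟩

theorem IsLargestRI.fundamentalEquiv {α β : ℝ} {φ : ℝ → ℝ} {ρ σ : (ℝ → ℝ) → ℝ≥0∞}
    (hρ : IsLargestRI α β φ ρ) (hσ : IsLargestRI α β φ σ) :
    FundamentalEquiv (riNorm ρ) (riNorm σ) := by
  obtain ⟨C, hC⟩ := hρ.exists_le_mul hσ
  obtain ⟨C', hC'⟩ := hσ.exists_le_mul hρ
  refine ⟨max C C', fun t _ => ?_⟩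
  rw [riNorm, riNorm, chi_abs]
  constructor
  · exact (hC _ (memMPlus_chi t)).trans (by gcongr; exact le_max_left _ _)
  · exact (hC' _ (memMPlus_chi t)).trans (by gcongr; exact le_max_right _ _)

theorem IsYoungDensity.youngEstimate {b B : ℝ → ℝ} (h : IsYoungDensity b B) {α : ℝ} {ψ : ℝ → ℝ}
    (hψ : IsWeight ψ) (hα0 : 0 < α) (hα : α < 1)
    (hE : FundamentalEquiv (luxemburgNorm B) (riNorm (optimalNorm α ψ))) :
    ∃ D, 0 < D ∧ YoungEstimate α ψ B D := by
  obtain ⟨C, hC⟩ := hE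
  have hCα : 0 ≤ (C : ℝ) / α := by positivity
  -- The first estimate needs `D > C / α`, the second `D > C`; the summand `1` supplies strictness.
  refine ⟨C / α + C + 1, by positivity, fun t ht => ?_⟩
  have hS : 0 < t * tail α ψ t := mul_pos ht.1 (hψ.tail_pos hα ht)
  obtain ⟨h1, h2⟩ := hC t ht
  rw [riNorm, chi_abs] at h1 h2
  have hup := hψ.optimalNorm_chi_le hα0 hα ht
  have hlo := hψ.le_optimalNorm_chi hα0 hα ht
  set S := t * tail α ψ t
  constructor
  · refine h.mul_le_one_of_luxemburgNorm_lt ht (h1.trans_lt ?_)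
    calc (C : ℝ≥0∞) * optimalNorm α ψ (chi t) ≤ C * ENNReal.ofReal (1 / α * S) := by gcongr
      _ = ENNReal.ofReal (C * (1 / α * S)) := by
          rw [ENNReal.ofReal_mul C.coe_nonneg, ENNReal.ofReal_coe_nnreal]
      _ < _ := by
          rw [ENNReal.ofReal_lt_ofReal_iff (by positivity)]
          have : 0 < (C + 1) * S := by positivity
          calc _ = C / α * S := by ring
            _ < _ := by linarith
  · by_contra hcon
    rw [not_lt] at hcon
    have h3 := h.luxemburgNorm_chi_le ht (m := S / (C / α + C + 1)) (by positivity)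
      (by rwa [one_div_div])
    have h4 : ENNReal.ofReal S ≤ ENNReal.ofReal (C * (S / (C / α + C + 1))) := by
      rw [ENNReal.ofReal_mul C.coe_nonneg, ENNReal.ofReal_coe_nnreal]
      exact hlo.trans (h2.trans (by gcongr))
    rw [ENNReal.ofReal_le_ofReal_iff (by positivity), mul_div_assoc', le_div_iff₀ (by positivity)]
      at h4
    nlinarith [mul_nonneg hCα hS.le]

theorem YoungEstimate.fundamentalEquiv {b B : ℝ → ℝ} (h : IsYoungDensity b B) {α : ℝ} {ψ : ℝ → ℝ}
    (hψ : IsWeight ψ) (hα0 : 0 < α) (hα : α < 1) {D : ℝ} (hD : 0 < D)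
    (hE : YoungEstimate α ψ B D) :
    FundamentalEquiv (luxemburgNorm B) (riNorm (optimalNorm α ψ)) := by
  refine ⟨(D + D / α).toNNReal, fun t ht => ?_⟩
  have hS : 0 < t * tail α ψ t := mul_pos ht.1 (hψ.tail_pos hα ht)
  obtain ⟨h1, h2⟩ := hE t ht
  rw [riNorm, chi_abs]
  have hup := hψ.optimalNorm_chi_le hα0 hα ht
  have hlo := hψ.le_optimalNorm_chi hα0 hα ht
  set S := t * tail α ψ t
  have hDα : 0 < D / α := by positivity
  rw [← ENNReal.ofReal]
  constructor
  · calc luxemburgNorm B (chi t) ≤ ENNReal.ofReal (D * S) :=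
          h.luxemburgNorm_chi_le ht (by positivity) h1
      _ = ENNReal.ofReal D * ENNReal.ofReal S := ENNReal.ofReal_mul hD.le
      _ ≤ _ := by gcongr; linarith
  · have h3 : ENNReal.ofReal (S / D) ≤ luxemburgNorm B (chi t) := by
      by_contra hcon
      have := h.mul_le_one_of_luxemburgNorm_lt ht (not_le.1 hcon)
      rw [one_div_div] at this
      linarith
    calc optimalNorm α ψ (chi t) ≤ ENNReal.ofReal (1 / α * S) := hup
      _ = ENNReal.ofReal (D / α) * ENNReal.ofReal (S / D) := by
          rw [← ENNReal.ofReal_mul hDα.le]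
          congr 1
          field_simp
      _ ≤ _ := by gcongr; linarith

/-! ### Construction of the Young function -/

/-- The infimum of `tail α ψ t` over those `t` with `r * (t * tail α ψ t) < 1`. -/
noncomputable def levelInf (α : ℝ) (ψ : ℝ → ℝ) (r : ℝ) : ℝ :=
  sInf (tail α ψ '' {t | t ∈ Ioo (0 : ℝ) 1 ∧ r * (t * tail α ψ t) < 1})

namespace IsWeight

variable {α : ℝ} {ψ : ℝ → ℝ}

theorem levelSet_nonempty (hψ : IsWeight ψ) (hα0 : 0 < α) (hα : α < 1) {r : ℝ} (hr : 0 ≤ r) :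
    {t | t ∈ Ioo (0 : ℝ) 1 ∧ r * (t * tail α ψ t) < 1}.Nonempty := by
  obtain ⟨M, hM0, hM⟩ := hψ.bdd
  have hlim : Tendsto (fun t : ℝ => r * (M * t ^ α)) (𝓝[>] 0) (𝓝 (r * (M * 0 ^ α))) :=
    ((((Real.continuousAt_rpow_const 0 α (Or.inr hα0.le)).tendsto).mono_left
      nhdsWithin_le_nhds).const_mul M).const_mul r
  rw [Real.zero_rpow hα0.ne', mul_zero, mul_zero] at hlim
  have h1 : ∀ᶠ t : ℝ in 𝓝[>] 0, t ∈ Ioo (0 : ℝ) 1 := Ioo_mem_nhdsGT one_pos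
  obtain ⟨t, ht, ht1⟩ := ((hlim.eventually (gt_mem_nhds one_pos)).and h1).exists
  refine ⟨t, ht1, lt_of_le_of_lt ?_ ht⟩
  exact mul_le_mul_of_nonneg_left (mul_tail_le hα hM0 hM ht1) hr

theorem levelInf_le (hψ : IsWeight ψ) (hα : α < 1) {r t : ℝ} (ht : t ∈ Ioo (0 : ℝ) 1)
    (h : r * (t * tail α ψ t) < 1) : levelInf α ψ r ≤ tail α ψ t :=
  csInf_le ⟨0, by rintro _ ⟨s, hs, rfl⟩; exact (hψ.tail_pos hα hs.1).le⟩ ⟨t, ⟨ht, h⟩, rfl⟩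

theorem le_levelInf (hψ : IsWeight ψ) (hα0 : 0 < α) (hα : α < 1) {r m : ℝ} (hr : 0 ≤ r)
    (h : ∀ t ∈ Ioo (0 : ℝ) 1, r * (t * tail α ψ t) < 1 → m ≤ tail α ψ t) : m ≤ levelInf α ψ r :=
  le_csInf ((hψ.levelSet_nonempty hα0 hα hr).image _)
    (by rintro _ ⟨s, hs, rfl⟩; exact h s hs.1 hs.2)

theorem levelInf_pos (hψ : IsWeight ψ) (hα0 : 0 < α) (hα : α < 1) {r : ℝ} (hr : 0 ≤ r) :
    0 < levelInf α ψ r :=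
  (hψ.pos (1 / 2) (by constructor <;> norm_num)).trans_le
    (hψ.le_levelInf hα0 hα hr fun _ ht _ => hψ.half_le_tail hα ht)

theorem levelInf_monotoneOn (hψ : IsWeight ψ) (hα0 : 0 < α) (hα : α < 1) :
    MonotoneOn (levelInf α ψ) (Ici 0) := by
  intro r hr r' hr' hrr'
  refine hψ.le_levelInf hα0 hα hr' fun t ht h => hψ.levelInf_le hα ht (lt_of_le_of_lt ?_ h)
  exact mul_le_mul_of_nonneg_right hrr' (mul_pos ht.1 (hψ.tail_pos hα ht)).le

/-- The strict inequality in `levelInf` survives a small increase of `r`, which is what right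
continuity needs. -/
theorem levelInf_continuousWithinAt (hψ : IsWeight ψ) (hα0 : 0 < α) (hα : α < 1) {r : ℝ}
    (hr : 0 ≤ r) : ContinuousWithinAt (levelInf α ψ) (Ici r) r := by
  refine tendsto_order.2 ⟨fun m hm => ?_, fun m hm => ?_⟩
  · filter_upwards [self_mem_nhdsWithin] with r' hr'
    exact hm.trans_le (hψ.levelInf_monotoneOn hα0 hα hr (hr.trans hr') hr')
  · obtain ⟨_, ⟨t, ht, rfl⟩, htm⟩ := exists_lt_of_csInf_lt
      ((hψ.levelSet_nonempty hα0 hα hr).image _) hm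
    have hc : ContinuousAt (fun r' : ℝ => r' * (t * tail α ψ t)) r := by fun_prop
    filter_upwards [nhdsWithin_le_nhds (hc.eventually (gt_mem_nhds ht.2))] with r' hr'
    exact (hψ.levelInf_le hα ht.1 hr').trans_lt htm

theorem levelInf_tendsto (hψ : IsWeight ψ) (hα0 : 0 < α) (hα : α < 1)
    (hsup : ¬ BddAbove ((fun t : ℝ => ψ t * t ^ (α - 1)) '' Ioo 0 1)) :
    Tendsto (levelInf α ψ) atTop atTop := by
  refine tendsto_atTop.2 fun R => ?_
  obtain ⟨_, ⟨t, ht, rfl⟩, hR⟩ := not_bddAbove_iff.1 hsup R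
  have hS := mul_pos ht.1 (hψ.tail_pos hα ht)
  filter_upwards [eventually_ge_atTop (1 / (t * tail α ψ t))] with r hr
  have hr0 : 0 ≤ r := le_trans (by positivity) hr
  refine hψ.le_levelInf hα0 hα hr0 fun s hs h => ?_
  have hst : s ≤ t := by
    by_contra hcon
    have h1 : t * tail α ψ t ≤ s * tail α ψ s :=
      hψ.mul_tail_monotoneOn hα0 hα ht hs (not_le.1 hcon).le
    have h2 := (div_le_iff₀ hS).1 hr
    nlinarith
  exact hR.le.trans ((hψ.le_tail hα ht.1 le_rfl ht.2).trans (hψ.tail_antitoneOn hα hs ht hst))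

/-- At `x = 1 / (t * tail α ψ t)` the density is comparable to `tail α ψ t` up to a dilation of `x`,
so `B x ≈ x b(x) ≈ 1/t`, as the prescribed fundamental function demands. Unboundedness of `ψ(t) t ^
(α - 1)` is what makes the density tend to infinity. -/
theorem exists_young (hψ : IsWeight ψ) (hα0 : 0 < α) (hα : α < 1)
    (hsup : ¬ BddAbove ((fun t : ℝ => ψ t * t ^ (α - 1)) '' Ioo 0 1)) :
    ∃ B, IsYoung B ∧ FundamentalEquiv (luxemburgNorm B) (riNorm (optimalNorm α ψ)) := by
  -- `levelInf` is positive at `0`; the factor `min 1 r` enforces `b 0 = 0` and changes nothing for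
  -- `r ≥ 1`.
  set b : ℝ → ℝ := fun r => min 1 r * levelInf α ψ r with hbdef
  set B : ℝ → ℝ := fun t => ∫ s in (0 : ℝ)..t, b s
  have h : IsYoungDensity b B := by
    refine ⟨by simp [hbdef], fun s hs => mul_pos (lt_min one_pos hs)
      (hψ.levelInf_pos hα0 hα hs.le), fun s hs t ht hst => ?_, ?_, fun _ _ => rfl⟩
    · exact mul_le_mul (min_le_min le_rfl hst) (hψ.levelInf_monotoneOn hα0 hα hs ht hst)
        (hψ.levelInf_pos hα0 hα hs).le (le_min zero_le_one ht)
    · refine (hψ.levelInf_tendsto hα0 hα hsup).congr' ?_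
      filter_upwards [eventually_ge_atTop 1] with r hr
      simp [hbdef, min_eq_left hr]
  refine ⟨B, ⟨b, h.zero, h.pos, fun s hs => ContinuousWithinAt.mul (by fun_prop)
    (hψ.levelInf_continuousWithinAt hα0 hα hs), h.mono, h.tendsto, h.eq⟩, ?_⟩
  obtain ⟨M, hM0, hM⟩ := hψ.bdd
  set c := min 1 (1 / M)
  have hc : 0 < c := by positivity
  have hc1 : c ≤ 1 := min_le_left _ _
  -- `c` bounds `min 1 x` from below, since `t * tail α ψ t ≤ M`. The lower estimate is `B (2 * x) ≥
  -- c / t`; convexity with factor `c / 2` raises it to `B (4 / c * x) ≥ 2 / t`, hence the strict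
  -- inequality.
  refine YoungEstimate.fundamentalEquiv h hψ hα0 hα (D := 4 / c) (by positivity) fun t ht => ?_
  have hS := hψ.tail_pos hα ht
  have ht0 := ht.1
  set x := 1 / (t * tail α ψ t) with hx
  have hx0 : 0 < x := by positivity
  constructor
  · have h1 : 1 / (4 / c * (t * tail α ψ t)) ≤ x / 2 := by
      have h4 : 2 ≤ 4 / c := by
        rw [le_div_iff₀ hc]
        linarith
      rw [hx, div_div]
      refine one_div_le_one_div_of_le (by positivity) ?_
      rw [mul_comm]
      gcongr
    have h2 : levelInf α ψ (x / 2) ≤ tail α ψ t := by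
      refine hψ.levelInf_le hα ht ?_
      rw [hx]
      field_simp
      norm_num
    have h3 : b (x / 2) ≤ tail α ψ t := by
      refine le_trans ?_ h2
      exact mul_le_of_le_one_left (hψ.levelInf_pos hα0 hα (by positivity)).le (min_le_left _ _)
    calc t * B (1 / (4 / c * (t * tail α ψ t))) ≤ t * B (x / 2) := by
          gcongr
          exact h.monotoneOn (mem_Ici.2 (by positivity)) (mem_Ici.2 (by positivity)) h1
      _ ≤ t * (x / 2 * b (x / 2)) := by gcongr; exact h.le_mul_density (by positivity)
      _ ≤ t * (x / 2 * tail α ψ t) := by gcongr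
      _ ≤ 1 := by
          rw [hx]
          field_simp
          norm_num
  · have h1 : tail α ψ t ≤ levelInf α ψ x := by
      refine hψ.le_levelInf hα0 hα hx0.le fun s hs hlt => hψ.tail_antitoneOn hα hs ht ?_
      by_contra hcon
      have h1 : t * tail α ψ t ≤ s * tail α ψ s :=
        hψ.mul_tail_monotoneOn hα0 hα ht hs (not_le.1 hcon).le
      rw [hx, one_div_mul_eq_div, div_lt_one (by positivity)] at hlt
      linarith
    have h2 : c ≤ min 1 x := by
      refine min_le_min le_rfl (one_div_le_one_div_of_le (by positivity) ?_)
      refine (mul_tail_le hα hM0 hM ht).trans (mul_le_of_le_one_right hM0.le ?_)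
      exact Real.rpow_le_one ht0.le ht.2.le hα0.le
    have h3 : c * tail α ψ t ≤ b x := mul_le_mul h2 h1 hS.le (hc.le.trans h2)
    have h4 : c / t ≤ B (2 * x) := by
      refine le_trans ?_ (h.mul_density_le hx0.le)
      calc c / t = x * (c * tail α ψ t) := by rw [hx]; field_simp
        _ ≤ _ := by gcongr
    have h5 := h.mul_le (θ := c / 2) (s := 4 / c / (t * tail α ψ t)) (by positivity) (by linarith)
      (by positivity)
    rw [show c / 2 * (4 / c / (t * tail α ψ t)) = 2 * x by rw [hx]; field_simp; norm_num] at h5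
    have h6 : c / t ≤ c / 2 * B (4 / c / (t * tail α ψ t)) := h4.trans h5
    rw [div_le_iff₀ ht0] at h6
    nlinarith

end IsWeight

/-! ### The integral condition -/

/-- Put `y = tail α ψ t / D` and `s₁ = D / (t * tail α ψ t)`, so `s₁ y = 1/t`. Up to `s₁` the
product `s y` is at most `1/t`; beyond it, convexity and `B s₁ > 1/t` give `B s ≥ s y`. -/
theorem YoungEstimate.complementary_le {b B : ℝ → ℝ} (h : IsYoungDensity b B) {α : ℝ} {ψ : ℝ → ℝ}
    (hψ : IsWeight ψ) (hα : α < 1) {D : ℝ} (hD : 0 < D) (hE : YoungEstimate α ψ B D) {t : ℝ}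
    (ht : t ∈ Ioo (0 : ℝ) 1) : complementary B (tail α ψ t / D) ≤ 1 / t := by
  have hS := hψ.tail_pos hα ht
  have ht0 := ht.1
  refine IsYoungDensity.complementary_le fun s hs => ?_
  set s₁ := D / (t * tail α ψ t) with hs₁
  have hs₁0 : 0 < s₁ := by positivity
  have e : s₁ * (tail α ψ t / D) = 1 / t := by
    rw [hs₁]
    field_simp
  have hy : 0 < tail α ψ t / D := by positivity
  rcases le_total s s₁ with hle | hle
  · have h1 := h.nonneg hs.le
    have h2 : s * (tail α ψ t / D) ≤ s₁ * (tail α ψ t / D) := by gcongr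
    linarith
  · have h1 := h.mul_le (θ := s₁ / s) (s := s) (by positivity) ((div_le_one hs).2 hle) hs.le
    rw [div_mul_cancel₀ _ hs.ne', div_mul_eq_mul_div, le_div_iff₀ hs] at h1
    have h2 : 1 / t < B s₁ := by
      rw [div_lt_iff₀' ht0]
      exact (hE t ht).2
    have h3 : s * (tail α ψ t / D) ≤ B s := by
      have h4 : s₁ * (s * (tail α ψ t / D)) ≤ s₁ * B s := by
        calc s₁ * (s * (tail α ψ t / D)) = 1 / t * s := by rw [← e]; ring
          _ ≤ B s₁ * s := by gcongr
          _ ≤ s₁ * B s := h1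
      exact le_of_mul_le_mul_left h4 hs₁0
    have : 0 < 1 / t := by positivity
    linarith

theorem YoungEstimate.le_complementary {b B : ℝ → ℝ} (h : IsYoungDensity b B) {α : ℝ} {ψ : ℝ → ℝ}
    (hψ : IsWeight ψ) (hα : α < 1) {D : ℝ} (hD : 0 < D) (hE : YoungEstimate α ψ B D) {t : ℝ}
    (ht : t ∈ Ioo (0 : ℝ) 1) : 1 / t ≤ complementary B (2 * D * tail α ψ t) := by
  have hS := hψ.tail_pos hα ht
  have ht0 := ht.1
  have h1 := h.young (s := 1 / (D * (t * tail α ψ t))) (y := 2 * D * tail α ψ t)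
    (by positivity) (by positivity)
  have e : 1 / (D * (t * tail α ψ t)) * (2 * D * tail α ψ t) = 2 * (1 / t) := by field_simp
  have h2 : B (1 / (D * (t * tail α ψ t))) ≤ 1 / t := by
    rw [le_div_iff₀' ht0]
    exact (hE t ht).1
  linarith

namespace IsYoungDensity

variable {a A : ℝ → ℝ}

theorem continuousOn_div_rpow (h : IsYoungDensity a A) (q : ℝ) {x y : ℝ} (hx : 0 < x) :
    ContinuousOn (fun s => complementary A s / s ^ q) (Icc x y) := by
  refine ((h.complementary_continuousOn y).mono (Icc_subset_Icc_left hx.le)).div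
    (fun s hs => (Real.continuousAt_rpow_const s q
      (Or.inl (hx.trans_le hs.1).ne')).continuousWithinAt) fun s hs => ?_
  exact (Real.rpow_pos_of_pos (hx.trans_le hs.1) _).ne'

theorem intervalIntegrable_div_rpow (h : IsYoungDensity a A) (q : ℝ) {x y : ℝ} (hx : 0 < x)
    (hy : 0 < y) : IntervalIntegrable (fun s => complementary A s / s ^ q) volume x y :=
  (h.continuousOn_div_rpow q (lt_min hx hy)).intervalIntegrable

theorem integral_div_rpow_nonneg (h : IsYoungDensity a A) (q : ℝ) {x y : ℝ} (hx : 0 < x)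
    (hxy : x ≤ y) : 0 ≤ ∫ s in x..y, complementary A s / s ^ q :=
  intervalIntegral.integral_nonneg hxy fun _ hs =>
    div_nonneg (h.complementary_nonneg (hx.le.trans hs.1)) (Real.rpow_nonneg (hx.le.trans hs.1) _)

/-- The substitution `y = c * s ^ (α - 1)`. -/
theorem integral_comp_rpow (h : IsYoungDensity a A) {α : ℝ} (hα : α < 1) {c τ : ℝ} (hc : 0 < c)
    (hτ : τ ∈ Ioo (0 : ℝ) 1) :
    ∫ s in τ..1, complementary A (c * s ^ (α - 1))
      = 1 / (1 - α) * c ^ (1 / (1 - α)) *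
        ∫ y in c..c * τ ^ (α - 1), complementary A y / y ^ (1 / (1 - α) + 1) := by
  have hα' : 0 < 1 - α := by linarith
  set p := 1 / (1 - α) with hp
  have hpα : (α - 1) * p = -1 := by
    rw [hp]
    field_simp
    ring
  have hpos : ∀ s ∈ uIcc τ 1, 0 < s := fun s hs => by
    rw [uIcc_of_le hτ.2.le] at hs
    exact hτ.1.trans_le hs.1
  have hcpos : ∀ s ∈ uIcc τ 1, c ≤ c * s ^ (α - 1) := fun s hs => by
    have h1 := hpos s hs
    rw [uIcc_of_le hτ.2.le] at hs
    exact le_mul_of_one_le_right hc.le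
      (Real.one_le_rpow_of_pos_of_le_one_of_nonpos h1 hs.2 (by linarith))
  have hcle : ∀ s ∈ uIcc τ 1, c * s ^ (α - 1) ≤ c * τ ^ (α - 1) := fun s hs => by
    rw [uIcc_of_le hτ.2.le] at hs
    gcongr c * ?_
    exact Real.rpow_le_rpow_of_nonpos hτ.1 hs.1 (by linarith)
  have hsub := intervalIntegral.integral_comp_mul_deriv'' (a := τ) (b := 1)
    (f := fun s => c * s ^ (α - 1)) (f' := fun s => c * ((α - 1) * s ^ (α - 1 - 1)))
    (g := fun y => complementary A y / y ^ (p + 1))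
    (fun s hs => ((Real.continuousAt_rpow_const s _
      (Or.inl (hpos s hs).ne')).const_mul c).continuousWithinAt)
    (fun s hs => ((Real.hasDerivAt_rpow_const
      (Or.inl (hpos s (Ioo_subset_Icc_self hs)).ne')).const_mul c).hasDerivWithinAt)
    (fun s hs => (((Real.continuousAt_rpow_const s _
      (Or.inl (hpos s hs).ne')).const_mul (α - 1)).const_mul c).continuousWithinAt)
    ((h.continuousOn_div_rpow (p + 1) hc (y := c * τ ^ (α - 1))).mono (by
      rintro _ ⟨s, hs, rfl⟩
      exact ⟨hcpos s hs, hcle s hs⟩))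
  rw [Real.one_rpow, mul_one, intervalIntegral.integral_symm c (c * τ ^ (α - 1))] at hsub
  have hpw : ∫ s in τ..1, ((fun y => complementary A y / y ^ (p + 1)) ∘ fun s => c * s ^ (α - 1)) s *
        (c * ((α - 1) * s ^ (α - 1 - 1)))
      = ∫ s in τ..1, (α - 1) * c ^ (-p) * complementary A (c * s ^ (α - 1)) := by
    refine intervalIntegral.integral_congr fun s hs => ?_
    have hs0 := hpos s hs
    -- Since `(α - 1) p = -1`, the weight `y ^ (p + 1)` reproduces the power of `s` in the Jacobian
    -- and cancels it.
    have e1 : (c * s ^ (α - 1)) ^ (p + 1) = c ^ p * c * (s ^ (α - 1 - 1)) := by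
      rw [Real.mul_rpow hc.le (Real.rpow_nonneg hs0.le _), Real.rpow_add_one hc.ne',
        ← Real.rpow_mul hs0.le]
      congr 2
      linarith
    have e2 : 0 < s ^ (α - 1 - 1) := Real.rpow_pos_of_pos hs0 _
    have e3 : 0 < c ^ p := Real.rpow_pos_of_pos hc _
    simp only [Function.comp]
    rw [e1, Real.rpow_neg hc.le]
    field_simp
  rw [hpw, intervalIntegral.integral_const_mul] at hsub
  have e3 : 0 < c ^ p := Real.rpow_pos_of_pos hc _
  rw [Real.rpow_neg hc.le] at hsub
  have : ∫ y in c..c * τ ^ (α - 1), complementary A y / y ^ (p + 1)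
      = (1 - α) * (c ^ p)⁻¹ * ∫ s in τ..1, complementary A (c * s ^ (α - 1)) := by linarith
  rw [this, hp]
  field_simp

theorem setLIntegral_comp_rpow (h : IsYoungDensity a A) {α : ℝ} (hα : α < 1) {c τ : ℝ}
    (hc : 0 < c) (hτ : τ ∈ Ioo (0 : ℝ) 1) :
    ∫⁻ s in Ioo τ 1, ENNReal.ofReal (complementary A (c * s ^ (α - 1)))
      = ENNReal.ofReal (1 / (1 - α) * c ^ (1 / (1 - α)) *
        ∫ y in c..c * τ ^ (α - 1), complementary A y / y ^ (1 / (1 - α) + 1)) := by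
  rw [← h.integral_comp_rpow hα hc hτ, intervalIntegral.integral_of_le hτ.2.le,
    integral_Ioc_eq_integral_Ioo, ofReal_integral_eq_lintegral_ofReal]
  · have hcont : ContinuousOn (fun s => complementary A (c * s ^ (α - 1))) (Icc τ 1) := by
      refine (h.complementary_continuousOn (c * τ ^ (α - 1))).comp (fun s hs =>
        ((Real.continuousAt_rpow_const s _
          (Or.inl (hτ.1.trans_le hs.1).ne')).const_mul c).continuousWithinAt) fun s hs => ⟨?_, ?_⟩
      · exact mul_nonneg hc.le (Real.rpow_nonneg (hτ.1.le.trans hs.1) _)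
      · gcongr c * ?_
        exact Real.rpow_le_rpow_of_nonpos hτ.1 hs.1 (by linarith)
    exact hcont.integrableOn_Icc.mono_set Ioo_subset_Icc_self
  · refine (ae_restrict_iff' measurableSet_Ioo).2 (ae_of_all _ fun s hs => ?_)
    exact h.complementary_nonneg (mul_nonneg hc.le (Real.rpow_nonneg (hτ.1.le.trans hs.1.le) _))

/-- Necessity of the integral condition. -/
theorem integral_condition (h : IsYoungDensity a A) {b B : ℝ → ℝ} (hB : IsYoungDensity b B)
    {α : ℝ} {ψ : ℝ → ℝ} (hψ : IsWeight ψ) (hα : α < 1)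
    (hsup : ¬ BddAbove ((fun t : ℝ => ψ t * t ^ (α - 1)) '' Ioo 0 1))
    {D : ℝ} (hD : 0 < D) (hE : YoungEstimate α ψ B D) {c₀ : ℝ} (hc₀ : 0 < c₀)
    (hI : ∀ τ ∈ Ioo (0 : ℝ) 1, ∫⁻ s in Ioo τ 1, ENNReal.ofReal
      (complementary A (c₀ * ψ τ * s ^ (α - 1))) ≤ 1) :
    ∃ C : ℝ, 0 < C ∧ ∃ K : ℝ, 0 < K ∧ ∀ t : ℝ, 2 < t →
      ∫ s in (1 : ℝ)..t, complementary A s / s ^ (1 / (1 - α) + 1) ≤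
        K * (complementary B (C * t) / t ^ (1 / (1 - α))) := by
  obtain ⟨M, hM0, hM⟩ := hψ.bdd
  have hα' : 0 < 1 - α := by linarith
  set c := min c₀ (1 / M)
  have hc : 0 < c := by positivity
  set p := 1 / (1 - α) with hp
  have hp0 : 0 < p := by positivity
  have hpα : (α - 1) * p = -1 := by
    rw [hp]
    field_simp
    ring
  have hB1 := hB.nonneg zero_le_one
  -- `2 * D / c` serves the case `2 * τ < 1` below; `1 + B 1` serves `2 * τ ≥ 1`, where the
  -- complementary function of `B` only has to be at least `1`.
  refine ⟨max (2 * D / c) (1 + B 1), by positivity, 2 / p, by positivity, fun t ht => ?_⟩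
  set C := max (2 * D / c) (1 + B 1)
  have ht0 : 0 < t := by linarith
  have hC0 : 0 < C := by positivity
  obtain ⟨_, ⟨τ₁, hτ₁, rfl⟩, hgt⟩ := not_bddAbove_iff.1 hsup (t / c)
  set T := {τ | τ ∈ Ioo (0 : ℝ) 1 ∧ t ≤ c * (ψ τ * τ ^ (α - 1))}
  have hTne : T.Nonempty := ⟨τ₁, hτ₁, by
    rw [div_lt_iff₀' hc] at hgt
    exact hgt.le⟩
  have hTb : BddAbove T := ⟨1, fun τ hτ => hτ.1.2.le⟩
  have hsT : 0 < sSup T := hTne.some_mem.1.1.trans_le (le_csSup hTb hTne.some_mem)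
  -- `T` is nonempty by unboundedness of `ψ(τ) τ ^ (α - 1)`. Its supremum need not be attained; `τ >
  -- sSup T / 2` is enough, since no point from `2 * τ` on lies in `T`, which bounds `tail α ψ (2 *
  -- τ)` by `t / c`.
  obtain ⟨τ, ⟨hτ, htτ⟩, hhalf⟩ := exists_lt_of_lt_csSup hTne (half_lt_self hsT)
  have hψτ := hψ.pos τ hτ
  have hτ0 := hτ.1
  set c' := c * ψ τ with hc'
  have hc'0 : 0 < c' := by positivity
  have hc'1 : c' ≤ 1 := by
    calc c * ψ τ ≤ 1 / M * M := by
          gcongr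
          · exact min_le_right _ _
          · exact hM τ hτ
      _ = 1 := by field_simp
  have hrp : 0 < τ ^ (α - 1) := Real.rpow_pos_of_pos hτ0 _
  have htw : t ≤ c' * τ ^ (α - 1) := by
    rw [hc', mul_assoc]
    exact htτ
  have hcp : 0 < c' ^ p := Real.rpow_pos_of_pos hc'0 _
  have hint : p * c' ^ p * ∫ y in c'..c' * τ ^ (α - 1), complementary A y / y ^ (p + 1) ≤ 1 := by
    rw [← ENNReal.ofReal_le_one, ← h.setLIntegral_comp_rpow hα hc'0 hτ]
    refine le_trans (setLIntegral_mono' measurableSet_Ioo fun s hs => ?_) (hI τ hτ)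
    have hs0 := Real.rpow_pos_of_pos (hτ0.trans hs.1) (α - 1)
    refine ENNReal.ofReal_le_ofReal (h.complementary_monotoneOn (mem_Ici.2 (by positivity))
      (mem_Ici.2 (by positivity)) ?_)
    rw [hc']
    gcongr
    exact min_le_left _ _
  have hle : ∫ s in (1 : ℝ)..t, complementary A s / s ^ (p + 1)
      ≤ ∫ y in c'..c' * τ ^ (α - 1), complementary A y / y ^ (p + 1) := by
    refine intervalIntegral.integral_mono_interval hc'1 (by linarith) htw ?_
      (h.intervalIntegrable_div_rpow _ hc'0 (by linarith))
    refine (ae_restrict_iff' measurableSet_Ioc).2 (ae_of_all _ fun s hs => ?_)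
    exact div_nonneg (h.complementary_nonneg (hc'0.trans hs.1).le)
      (Real.rpow_nonneg (hc'0.trans hs.1).le _)
  have htp : 0 < t ^ p := Real.rpow_pos_of_pos ht0 _
  have hcpt : t ^ p * τ ≤ c' ^ p := by
    calc t ^ p * τ ≤ (c' * τ ^ (α - 1)) ^ p * τ := by gcongr
      _ = c' ^ p := by
        rw [Real.mul_rpow hc'0.le hrp.le, ← Real.rpow_mul hτ0.le, hpα, Real.rpow_neg_one]
        field_simp
  have hBt : 1 / (2 * τ) ≤ complementary B (C * t) := by
    rcases lt_or_ge (2 * τ) 1 with h2 | h2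
    · have h2τ : 2 * τ ∈ Ioo (0 : ℝ) 1 := ⟨by positivity, h2⟩
      have htail : tail α ψ (2 * τ) ≤ t / c := by
        refine IsWeight.tail_le h2 fun τ' h1 h3 => ?_
        rw [le_div_iff₀' hc]
        by_contra hcon
        have := le_csSup hTb (show τ' ∈ T from ⟨⟨h2τ.1.trans_le h1, h3⟩, (not_le.1 hcon).le⟩)
        linarith
      refine (hE.le_complementary hB hψ hα hD h2τ).trans ?_
      have := hψ.tail_pos hα h2τ
      refine hB.complementary_monotoneOn (mem_Ici.2 (by positivity)) (mem_Ici.2 (by positivity)) ?_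
      calc 2 * D * tail α ψ (2 * τ) ≤ 2 * D * (t / c) := by gcongr
        _ = 2 * D / c * t := by ring
        _ ≤ C * t := by gcongr; exact le_max_left _ _
    · have h3 : 1 / (2 * τ) ≤ 1 := by
        rw [div_le_one (by positivity)]
        exact h2
      have h4 := hB.young zero_le_one (show 0 ≤ C * t by positivity)
      have h5 : 1 + B 1 ≤ C := le_max_right _ _
      nlinarith
  have hIn := h.integral_div_rpow_nonneg (p + 1) one_pos (show 1 ≤ t by linarith)
  set I := ∫ s in (1 : ℝ)..t, complementary A s / s ^ (p + 1)
  have h6 : p * (t ^ p * τ) * I ≤ 1 := by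
    calc p * (t ^ p * τ) * I ≤ p * c' ^ p * I := by gcongr
      _ ≤ p * c' ^ p * ∫ y in c'..c' * τ ^ (α - 1), complementary A y / y ^ (p + 1) := by gcongr
      _ ≤ 1 := hint
  calc I ≤ 2 / p * (1 / (2 * τ) / t ^ p) := by
        rw [show 2 / p * (1 / (2 * τ) / t ^ p) = 1 / (p * (t ^ p * τ)) by field_simp,
          le_div_iff₀' (by positivity)]
        exact h6
    _ ≤ _ := by gcongr

/-- Sufficiency of the integral condition: bounds on `(τ,1)`. -/
theorem setLIntegral_le_of_condition (h : IsYoungDensity a A) {b B : ℝ → ℝ}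
    (hB : IsYoungDensity b B) {α : ℝ} {ψ : ℝ → ℝ} (hψ : IsWeight ψ) (hα : α < 1)
    {D : ℝ} (hD : 0 < D) (hE : YoungEstimate α ψ B D) {C K : ℝ} (hC : 0 < C) (hK : 0 < K)
    (hII : ∀ t : ℝ, 2 < t →
      ∫ s in (1 : ℝ)..t, complementary A s / s ^ (1 / (1 - α) + 1) ≤
        K * (complementary B (C * t) / t ^ (1 / (1 - α)))) :
    ∃ c, 0 < c ∧ ∃ L, 0 ≤ L ∧ ∀ τ ∈ Ioo (0 : ℝ) 1, ∫⁻ s in Ioo τ 1, ENNReal.ofReal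
      (complementary A (c * ψ τ * s ^ (α - 1))) ≤ ENNReal.ofReal L := by
  obtain ⟨M, hM0, hM⟩ := hψ.bdd
  have hα' : 0 < 1 - α := by linarith
  -- `1 / (C * D)` makes `C w ≤ tail α ψ τ / D`, where `YoungEstimate.complementary_le` applies; `1
  -- / M` gives `c' ≤ 1`, so the integral can be split at `1`.
  set c := min (1 / (C * D)) (1 / M)
  have hc : 0 < c := by positivity
  set p := 1 / (1 - α) with hp
  have hp0 : 0 < p := by positivity
  have hpα : (α - 1) * p = -1 := by
    rw [hp]
    field_simp
    ring
  have hA1 := h.complementary_nonneg zero_le_one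
  have hA3 := h.complementary_nonneg (show (0 : ℝ) ≤ 3 by norm_num)
  refine ⟨c, hc, complementary A 3 + complementary A 1 + p * K, by positivity, fun τ hτ => ?_⟩
  have hψτ := hψ.pos τ hτ
  have hτ0 := hτ.1
  set c' := c * ψ τ with hc'
  have hc'0 : 0 < c' := by positivity
  have hc'1 : c' ≤ 1 := by
    calc c * ψ τ ≤ 1 / M * M := by
          gcongr
          · exact min_le_right _ _
          · exact hM τ hτ
      _ = 1 := by field_simp
  have hrp : 0 < τ ^ (α - 1) := Real.rpow_pos_of_pos hτ0 _
  have hcp : 0 < c' ^ p := Real.rpow_pos_of_pos hc'0 _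
  -- The hypothesis is available only for endpoints above `2`; for `w ≤ 3` the integrand is bounded
  -- outright.
  rcases le_or_gt (c' * τ ^ (α - 1)) 3 with h3 | h3
  · calc _ ≤ ∫⁻ s in Ioo τ 1, ENNReal.ofReal (complementary A 3) := by
          refine setLIntegral_mono' measurableSet_Ioo fun s hs => ENNReal.ofReal_le_ofReal ?_
          have hs0 := Real.rpow_pos_of_pos (hτ0.trans hs.1) (α - 1)
          refine h.complementary_monotoneOn (mem_Ici.2 (by positivity)) (mem_Ici.2 (by norm_num)) ?_
          refine le_trans ?_ h3
          gcongr c' * ?_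
          exact Real.rpow_le_rpow_of_nonpos hτ0 hs.1.le (by linarith)
      _ ≤ ENNReal.ofReal (complementary A 3) * 1 := by
          rw [setLIntegral_const, Real.volume_Ioo]
          gcongr
          rw [ENNReal.ofReal_le_one]
          linarith
      _ ≤ _ := by
          rw [mul_one]
          refine ENNReal.ofReal_le_ofReal ?_
          have : 0 < p * K := by positivity
          linarith
  · rw [h.setLIntegral_comp_rpow hα hc'0 hτ]
    refine ENNReal.ofReal_le_ofReal ?_
    set w := c' * τ ^ (α - 1) with hw
    have hw0 : 0 < w := by positivity
    rw [← intervalIntegral.integral_add_adjacent_intervals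
      (h.intervalIntegrable_div_rpow (p + 1) hc'0 one_pos)
      (h.intervalIntegrable_div_rpow (p + 1) one_pos hw0), mul_add]
    -- Below `1` the numerator is at most its value at `1`, and `∫ y ^ (-p - 1)` from `c'` to `1` is
    -- less than `1 / (p c' ^ p)`, cancelling the prefactor.
    have h1 : p * c' ^ p * ∫ y in c'..1, complementary A y / y ^ (p + 1) ≤ complementary A 1 := by
      have e1 : ∫ y in c'..1, complementary A y / y ^ (p + 1)
          ≤ ∫ y in c'..1, complementary A 1 * y ^ (-p - 1) := by
        refine intervalIntegral.integral_mono_on hc'1 (h.intervalIntegrable_div_rpow _ hc'0 one_pos)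
          ?_ fun y hy => ?_
        · refine (ContinuousOn.intervalIntegrable fun y hy => ?_).const_mul _
          rw [uIcc_of_le hc'1] at hy
          exact (Real.continuousAt_rpow_const y _
            (Or.inl (hc'0.trans_le hy.1).ne')).continuousWithinAt
        · have hy0 := hc'0.trans_le hy.1
          rw [show -p - 1 = -(p + 1) by ring, Real.rpow_neg hy0.le, ← div_eq_mul_inv]
          have := Real.rpow_pos_of_pos hy0 (p + 1)
          gcongr
          exact h.complementary_monotoneOn hy0.le (mem_Ici.2 zero_le_one) hy.2
      have e2 : ∫ y in c'..1, y ^ (-p - 1) = ((c' ^ p)⁻¹ - 1) / p := by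
        rw [integral_rpow]
        · rw [Real.one_rpow, sub_add_cancel, Real.rpow_neg hc'0.le]
          field_simp
          ring
        · refine Or.inr ⟨by linarith, ?_⟩
          rw [uIcc_of_le hc'1]
          exact fun h0 => absurd h0.1 (not_le.2 hc'0)
      rw [intervalIntegral.integral_const_mul, e2] at e1
      calc _ ≤ p * c' ^ p * (complementary A 1 * (((c' ^ p)⁻¹ - 1) / p)) := by gcongr
        _ = complementary A 1 * (1 - c' ^ p) := by field_simp
        _ ≤ complementary A 1 := mul_le_of_le_one_right hA1 (by linarith)
    have h2 : p * c' ^ p * ∫ y in (1 : ℝ)..w, complementary A y / y ^ (p + 1) ≤ p * K := by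
      have e1 : complementary B (C * w) ≤ 1 / τ := by
        refine le_trans (hB.complementary_monotoneOn (mem_Ici.2 (by positivity)) (mem_Ici.2 ?_) ?_)
          (hE.complementary_le hB hψ hα hD hτ)
        · have := hψ.tail_pos hα hτ
          positivity
        · calc C * w = C * c * (ψ τ * τ ^ (α - 1)) := by rw [hw, hc']; ring
            _ ≤ C * (1 / (C * D)) * tail α ψ τ := by
              gcongr
              · exact min_le_left _ _
              · exact hψ.le_tail hα hτ0 le_rfl hτ.2
            _ = tail α ψ τ / D := by field_simp
      have e2 : w ^ p = c' ^ p / τ := by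
        rw [hw, Real.mul_rpow hc'0.le hrp.le, ← Real.rpow_mul hτ0.le, hpα, Real.rpow_neg_one]
        rfl
      calc _ ≤ p * c' ^ p * (K * (complementary B (C * w) / w ^ p)) := by
            gcongr
            exact hII w (by linarith)
        _ ≤ p * c' ^ p * (K * (1 / τ / w ^ p)) := by gcongr
        _ = p * K := by
            rw [e2]
            field_simp
    linarith

/-- The bounds on `(τ,1)` imply bounds for the full kernel. -/
theorem lintegral_kern_le (h : IsYoungDensity a A) {α : ℝ} {ψ : ℝ → ℝ} (hψ : IsWeight ψ)
    (hα0 : 0 < α) (hα : α < 1) {c L : ℝ} (hc : 0 < c) (hL : 0 ≤ L)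
    (hI : ∀ τ ∈ Ioo (0 : ℝ) 1, ∫⁻ s in Ioo τ 1, ENNReal.ofReal
      (complementary A (c * ψ τ * s ^ (α - 1))) ≤ ENNReal.ofReal L) :
    ∃ K, 0 ≤ K ∧ ∀ τ ∈ Ioo (0 : ℝ) 1, ∫⁻ s, ENNReal.ofReal
      (complementary A (c / 2 * ψ τ * kern α τ s)) ∂muI ≤ ENNReal.ofReal K := by
  obtain ⟨M, hM0, hM⟩ := hψ.bdd
  -- `y₀` bounds the argument when `τ ≥ 1/2`. For `τ ≤ 1/2` the translation by `τ` is used again,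
  -- and passing from `c` to `c / 2` absorbs the factor of `kern_le_rpow_add`.
  set y₀ := c / 2 * M * (1 / 2) ^ (α - 1)
  have hA := h.complementary_nonneg (y := y₀) (by positivity)
  refine ⟨2 * L + complementary A y₀, by positivity, fun τ hτ => ?_⟩
  have hψτ := hψ.pos τ hτ
  have hτ0 := hτ.1
  rcases le_total τ (1 / 2) with h2 | h2
  · set w : ℝ → ℝ≥0∞ := fun s => ENNReal.ofReal (complementary A (c / 2 * ψ τ * kern α τ s))
    have hw : AntitoneOn w (Ioo 0 1) := by
      intro s hs t ht hst
      have := kern_nonneg α hτ0 hs.1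
      have := kern_nonneg α hτ0 ht.1
      refine ENNReal.ofReal_le_ofReal (h.complementary_monotoneOn (mem_Ici.2 (by positivity))
        (mem_Ici.2 (by positivity)) ?_)
      gcongr
      exact kern_antitoneOn hα τ hs ht hst
    calc _ ≤ 2 * ∫⁻ s in Ioo 0 (1 / 2), w s := lintegral_Ioo_le_two_mul hw
      _ = 2 * ∫⁻ s in Ioo τ (1 / 2 + τ), w (s - τ) := by
          rw [← setLIntegral_comp_sub w τ 0 (1 / 2), zero_add]
      _ ≤ 2 * ∫⁻ s in Ioo τ 1, w (s - τ) := by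
          gcongr
          linarith
      _ ≤ 2 * ∫⁻ s in Ioo τ 1, ENNReal.ofReal (complementary A (c * ψ τ * s ^ (α - 1))) := by
          refine mul_le_mul_right (setLIntegral_mono' measurableSet_Ioo fun s hs => ?_) _
          have hs0 : 0 < s - τ := sub_pos.2 hs.1
          have h1 := kern_le_rpow_add hα0 hα hτ0 hs0
          rw [sub_add_cancel] at h1
          have := kern_nonneg α hτ0 hs0
          have := Real.rpow_pos_of_pos (hτ0.trans hs.1) (α - 1)
          refine ENNReal.ofReal_le_ofReal (h.complementary_monotoneOn (mem_Ici.2 (by positivity))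
            (mem_Ici.2 (by positivity)) ?_)
          calc c / 2 * ψ τ * kern α τ (s - τ) ≤ c / 2 * ψ τ * (2 * s ^ (α - 1)) := by gcongr
            _ = _ := by ring
      _ ≤ 2 * ENNReal.ofReal L := mul_le_mul_right (hI τ hτ) _
      _ = ENNReal.ofReal (2 * L) := by rw [ENNReal.ofReal_mul (by norm_num)]; simp
      _ ≤ _ := ENNReal.ofReal_le_ofReal (by linarith)
  · calc _ ≤ ∫⁻ s, ENNReal.ofReal (complementary A y₀) ∂muI := by
          refine lintegral_mono_ae ?_
          filter_upwards [ae_mem_Ioo] with s hs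
          have := kern_nonneg α hτ0 hs.1
          refine ENNReal.ofReal_le_ofReal (h.complementary_monotoneOn (mem_Ici.2 (by positivity))
            (mem_Ici.2 (by positivity)) ?_)
          refine mul_le_mul (by gcongr; exact hM τ hτ) ?_ this (by positivity)
          exact (min_le_left _ _).trans
            (Real.rpow_le_rpow_of_nonpos (by norm_num) h2 (by linarith))
      _ ≤ _ := by
          simp only [lintegral_const, measure_univ, mul_one]
          exact ENNReal.ofReal_le_ofReal (by linarith)

end IsYoungDensity

end OrliczMarcinkiewicz

/-! ### The main theorem -/

open OrliczMarcinkiewicz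
theorem theoremB (α β : ℝ) (hα0 : 0 < α) (hα1 : α < 1) (hβ : 0 < β) (hαβ : 1 ≤ α + 1 / β)
    (A : ℝ → ℝ) (hA : IsYoung A) (φ : ℝ → ℝ) (hφ : IsQuasiconcave φ)
    (hsup : ¬ BddAbove ((fun t : ℝ => φ (t ^ (1 / β)) * t ^ (α - 1)) '' Ioo 0 1)) :
    (∃ ρ : (ℝ → ℝ) → ℝ≥0∞, IsLargestRI α β φ ρ) ∧
    ∀ ρ : (ℝ → ℝ) → ℝ≥0∞, IsLargestRI α β φ ρ →
      (∃ B : ℝ → ℝ, IsYoung B ∧ FundamentalEquiv (luxemburgNorm B) (riNorm ρ)) ∧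
      ∀ B : ℝ → ℝ, IsYoung B → FundamentalEquiv (luxemburgNorm B) (riNorm ρ) →
        (HardyBounded α β (luxemburgNorm A) (marcinkiewiczNorm φ) ↔
          ∃ C : ℝ, 0 < C ∧ ∃ K : ℝ, 0 < K ∧ ∀ t : ℝ, 2 < t →
            ∫ s in (1 : ℝ)..t, complementary A s / s ^ (1 / (1 - α) + 1) ≤
              K * (complementary B (C * t) / t ^ (1 / (1 - α)))) := by
  have hψ := hφ.isWeight hβ
  have hopt := isLargestRI_optimalNorm hα0 hα1 hβ hαβ hφ
  obtain ⟨a, ha⟩ := hA.exists_density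
  refine ⟨⟨_, hopt⟩, fun ρ hρ => ⟨?_, fun B hB hE => ?_⟩⟩
  · obtain ⟨B, hB, hE⟩ := hψ.exists_young hα0 hα1 hsup
    exact ⟨B, hB, hE.trans (hopt.fundamentalEquiv hρ)⟩
  · obtain ⟨b, hb⟩ := hB.exists_density
    -- The given largest space is exchanged for the explicit one, whose fundamental function is
    -- known.
    obtain ⟨D, hD, hY⟩ := hb.youngEstimate hψ hα0 hα1 (hE.trans (hρ.fundamentalEquiv hopt))
    constructor
    · intro hH
      obtain ⟨c, hc, hI⟩ := ha.lintegral_complementary_le hα1 hβ hφ hH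
      exact ha.integral_condition hb hψ hα1 hsup hD hY hc hI
    · rintro ⟨C, hC, K, hK, hII⟩
      obtain ⟨c, hc, L, hL, hI⟩ := ha.setLIntegral_le_of_condition hb hψ hα1 hD hY hC hK hII
      obtain ⟨K', hK', hI'⟩ := ha.lintegral_kern_le hψ hα0 hα1 hc hL hI
      exact ha.hardyBounded hα1 hβ hαβ hφ (half_pos hc) hK' hI'
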